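/- Let $G$ be a biextraspecial group of rank $m$: $G$ is an extension of a normal $2$-subgroup $Q$ of order $2^{2+2m}$ by $G/Q\cong L_2(2)$, the centre $Z=Z(Q)$ is the natural $L_2(2)$-module, $Q/Z$ is elementary abelian of order $2^{2m}$, and all composition factors of the module $Q/Z$ are natural modules. Let $L\cong L_2(2)$ be a complement to $Q$ in $G$, and let $C=C_{\mathrm{Aut}(G)}(L)$ be the group of automorphisms of $G$ that fix every element of $L$. A dent is a normal subgroup $D$ of $G$ with $Z<D<Q$ such that $D/Z$ is an irreducible $L$-submodule of $Q/Z$. Let $\mathcal D$ be the set of all dents together with a formal zero $0$. For dents $D_1\neq D_2$ let $D_1+D_2$ be the full preimage in $Q$ of the diagonal $\{x\cdot\varphi(x) : x\in D_1/Z\}$, where $\varphi\colon D_1/Z\to D_2/Z$ is the unique $L$-isomorphism, and let $D+D=0$. Put $q(0)=0$, $q(D)=0$ if $D\cong 2^4$, and $q(D)=1$ for every other dent $D$. Put $\beta(D_1,D_2)=0$ if $D_1$ and $D_2$ commute elementwise, $\beta(D_1,D_2)=1$ otherwise, and $\beta(0,\cdot)=\beta(\cdot,0)=0$. Then: 1.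 The natural map $C\to \mathrm{Out}(G)=\mathrm{Aut}(G)/\mathrm{Inn}(G)$ is an isomorphism. 2. $(\mathcal D,+)$ is an $m$-dimensional vector space over $GF(2)$, and $q$ is a quadratic form on it whose associated bilinear form is $\beta$, which is nondegenerate. In particular $m=2n$ is even, and $(\mathcal D,q)$ is isometric to the standard orthogonal space of some type $\varepsilon\in\{+,-\}$ of dimension $m$: the orthogonal sum of $n$ hyperbolic planes if $\varepsilon=+$, and of one anisotropic plane and $n-1$ hyperbolic planes if $\varepsilon=-$. 3. $C$ acts linearly on $\mathcal D$ by $D\mapsto\alpha(D)$, preserving $q$. The image of this action is the whole orthogonal group of $(\mathcal D,q)$. Its kernel $K$ is elementary abelian of rank $m$, and $K$, with $C$ acting by conjugation, is isomorphic to $\mathcal D$ as a $C$-module. Consequently $C$ is an extension of $\mathcal D$ by $C/K\cong GO^{\varepsilon}_m(2)$, the orthogonal group of the standard space of type $\varepsilon$. -/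

import Mathlib

namespace Biextraspecial

/-! ### Biextraspecial groups

Throughout, `Q` is a normal subgroup of `G` and `L` denotes `G / Q` (or a complement of `Q`).
Since `Q` acts trivially on `Z(Q)` and on `Q / Z(Q)` when the latter is abelian, the `L`-module
structures on these sections are given by conjugation in `G`, and the `L`-submodules of
`Q / Z(Q)` are the quotients `N / Z(Q)` with `N` normal in `G` and `Z(Q) ≤ N ≤ Q`. -/

section Groups

variable {G : Type*} [Group G]

/-- The centre `Z = Z(Q)` of `Q`, as a subgroup of `G`. -/
def centre (Q : Subgroup G) : Subgroup G := (Subgroup.center Q).map Q.subtype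

instance centre_normal (Q : Subgroup G) [Q.Normal] : (centre Q).Normal := by
  unfold centre; infer_instance

/-- Let `π : G → L₂(2) = GL₂(2)` be a homomorphism. The section `B / A` (with `G` acting by
conjugation) is isomorphic to the natural module `𝔽₂²`, on which `G` acts through `π`:
there is a surjective homomorphism `B → 𝔽₂²` with kernel `A` that is `G`-equivariant. -/
def IsNaturalSection (π : G →* GL (Fin 2) (ZMod 2)) (A B : Subgroup G) : Prop :=
  ∃ f : B →* Multiplicative (Fin 2 → ZMod 2),
    Function.Surjective f ∧ f.ker = A.subgroupOf B ∧
    ∀ (g : G) (b b' : B), (b' : G) = g * b * g⁻¹ →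
      (f b').toAdd = Matrix.mulVec (π g : Matrix (Fin 2) (Fin 2) (ZMod 2)) (f b).toAdd

/-- `G` is a biextraspecial group of rank `m` with normal `2`-subgroup `Q`. -/
structure IsBiextraspecial (Q : Subgroup G) (m : ℕ) : Prop where
  /-- `Q` has order `2 ^ (2 + 2 * m)`. -/
  card_eq : Nat.card Q = 2 ^ (2 + 2 * m)
  /-- `Q / Z` is an elementary abelian `2`-group. -/
  commutator_mem : ∀ x ∈ Q, ∀ y ∈ Q, x * y * x⁻¹ * y⁻¹ ∈ centre Q
  sq_mem : ∀ x ∈ Q, x ^ 2 ∈ centre Q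
  /-- `G / Q ≅ L₂(2)`, the centre `Z` of `Q` is the natural module, and every composition
  factor `B / A` of the module `Q / Z` is the natural module. -/
  exists_module : ∃ π : G →* GL (Fin 2) (ZMod 2),
    Function.Surjective π ∧ π.ker = Q ∧ IsNaturalSection π ⊥ (centre Q) ∧
    ∀ A B : Subgroup G, A.Normal → B.Normal → centre Q ≤ A → A < B → B ≤ Q →
      (∀ N : Subgroup G, N.Normal → A ≤ N → N ≤ B → N = A ∨ N = B) →
      IsNaturalSection π A B

/-! ### Dents and the dent space -/

/-- A dent: a normal subgroup `D` of `G` with `Z < D < Q` such that `D / Z` is an irreducible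
submodule of `Q / Z`. -/
@[ext]
structure Dent (Q : Subgroup G) where
  /-- The underlying subgroup. -/
  carrier : Subgroup G
  normal : carrier.Normal
  centre_lt : centre Q < carrier
  lt : carrier < Q
  irreducible : ∀ N : Subgroup G, N.Normal → centre Q ≤ N → N ≤ carrier →
    N = centre Q ∨ N = carrier

/-- The image `D / Z` of a dent `D` in `G / Z`. -/
def Dent.bar {Q : Subgroup G} [Q.Normal] (D : Dent Q) : Subgroup (G ⧸ centre Q) :=
  D.carrier.map (QuotientGroup.mk' (centre Q))

/-- `φ : D₁ / Z → D₂ / Z` commutes with conjugation by elements of `G`, that is, it is an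
isomorphism of `L`-modules. -/
def IsModuleIso {Q : Subgroup G} [Q.Normal] {D₁ D₂ : Dent Q} (φ : D₁.bar ≃* D₂.bar) : Prop :=
  ∀ (g : G) (x x' : D₁.bar), (x' : G ⧸ centre Q) = (g : G ⧸ centre Q) * x * (g : G ⧸ centre Q)⁻¹ →
    (φ x' : G ⧸ centre Q) = (g : G ⧸ centre Q) * φ x * (g : G ⧸ centre Q)⁻¹

/-- `D₃` is the diagonal dent of `D₁` and `D₂`: the full preimage of the diagonal
`{x * φ x | x ∈ D₁ / Z}`, where `φ : D₁ / Z → D₂ / Z` is the isomorphism of `L`-modules. -/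
def IsDiagonal {Q : Subgroup G} [Q.Normal] (D₁ D₂ D₃ : Dent Q) : Prop :=
  ∃ φ : D₁.bar ≃* D₂.bar, IsModuleIso φ ∧
    ∀ g : G, g ∈ D₃.carrier ↔ ∃ x : D₁.bar, (g : G ⧸ centre Q) = x * φ x

/-- The underlying set of the dent space: all dents, together with a formal zero. -/
inductive DentSpace (Q : Subgroup G) where
  | zero : DentSpace Q
  | ofDent (D : Dent Q) : DentSpace Q

/-- The graph of the addition of the dent space: `IsDentSum x y z` means `x + y = z`. -/
inductive IsDentSum {Q : Subgroup G} [Q.Normal] :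
    DentSpace Q → DentSpace Q → DentSpace Q → Prop
  | zero_left (y : DentSpace Q) : IsDentSum .zero y y
  | zero_right (x : DentSpace Q) : IsDentSum x .zero x
  | self (D : Dent Q) : IsDentSum (.ofDent D) (.ofDent D) .zero
  | diagonal (D₁ D₂ D₃ : Dent Q) (hne : D₁ ≠ D₂) (h : IsDiagonal D₁ D₂ D₃) :
      IsDentSum (.ofDent D₁) (.ofDent D₂) (.ofDent D₃)

/-- A dent is singular if it is isomorphic to `2⁴`. -/
def Dent.IsSingular {Q : Subgroup G} (D : Dent Q) : Prop :=
  Nonempty (D.carrier ≃* Multiplicative (Fin 4 → ZMod 2))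

open Classical in
/-- The function `q` on the dent space: `0` at zero and at singular dents, `1` at the others. -/
noncomputable def dentQ {Q : Subgroup G} : DentSpace Q → ZMod 2
  | .zero => 0
  | .ofDent D => if D.IsSingular then 0 else 1

open Classical in
/-- The function `β` on the dent space: `0` if the arguments commute, `1` otherwise. -/
noncomputable def dentBeta {Q : Subgroup G} : DentSpace Q → DentSpace Q → ZMod 2
  | .zero, _ => 0
  | .ofDent _, .zero => 0
  | .ofDent D₁, .ofDent D₂ =>
      if ∀ x ∈ D₁.carrier, ∀ y ∈ D₂.carrier, x * y = y * x then 0 else 1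

/-! ### Automorphisms -/

variable (G) in
/-- The group of inner automorphisms of `G`. -/
def Inn : Subgroup (MulAut G) := (MulAut.conj : G →* MulAut G).range

instance Inn_normal : (Inn G).Normal where
  conj_mem := by
    rintro _ ⟨g, rfl⟩ α
    refine ⟨α g, ?_⟩
    ext x
    simp [MulAut.conj_apply]

variable (G) in
/-- The outer automorphism group of `G`. -/
abbrev Out : Type _ := MulAut G ⧸ Inn G

/-- The group `C = C_{Aut(G)}(L)` of the automorphisms of `G` that centralise `L`. -/
def autCentralizer (L : Subgroup G) : Subgroup (MulAut G) where
  carrier := {α | ∀ l ∈ L, α l = l}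
  one_mem' := fun _ _ => rfl
  mul_mem' := by
    intro α β hα hβ l hl
    rw [MulAut.mul_apply, hβ l hl, hα l hl]
  inv_mem' := by
    intro α hα l hl
    exact (MulEquiv.symm_apply_eq α).2 (hα l hl).symm

end Groups

/-! ### Orthogonal groups over `𝔽₂` -/

/-- The orthogonal group of a quadratic form `q`: all linear automorphisms preserving `q`. -/
def isometryGroup {K V : Type*} [CommRing K] [AddCommGroup V] [Module K V]
    (q : QuadraticForm K V) : Subgroup (V ≃ₗ[K] V) where
  carrier := {g | ∀ v, q (g v) = q v}
  one_mem' := fun _ => rfl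
  mul_mem' := by
    intro g h hg hh v
    rw [LinearEquiv.mul_apply, hg, hh]
  inv_mem' := by
    intro g hg v
    rw [← hg (g⁻¹ v), ← LinearEquiv.mul_apply, mul_inv_cancel]
    rfl

/-- The two types of nondegenerate quadratic forms over `𝔽₂` in even dimension. -/
inductive FormType
  | plus
  | minus

/-- The hyperbolic plane: `v ↦ v₀ v₁` on `𝔽₂²`. -/
def hyperbolicPlane : QuadraticForm (ZMod 2) (Fin 2 → ZMod 2) :=
  QuadraticMap.linMulLin (LinearMap.proj 0) (LinearMap.proj 1)

/-- The anisotropic plane: `v ↦ v₀² + v₀ v₁ + v₁²` on `𝔽₂²`. -/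
def anisotropicPlane : QuadraticForm (ZMod 2) (Fin 2 → ZMod 2) :=
  QuadraticMap.linMulLin (LinearMap.proj 0) (LinearMap.proj 0) +
    QuadraticMap.linMulLin (LinearMap.proj 0) (LinearMap.proj 1) +
    QuadraticMap.linMulLin (LinearMap.proj 1) (LinearMap.proj 1)

/-- The standard quadratic form of type `ε` in dimension `2 n`: the orthogonal sum of `n`
hyperbolic planes if `ε = +`, and of one anisotropic and `n - 1` hyperbolic planes if `ε = -`. -/
def stdForm (ε : FormType) (n : ℕ) : QuadraticForm (ZMod 2) (Fin n → Fin 2 → ZMod 2) :=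
  QuadraticMap.pi fun i =>
    match ε with
    | .plus => hyperbolicPlane
    | .minus => if i.val = 0 then anisotropicPlane else hyperbolicPlane

/-- The orthogonal group `GO^ε_{2n}(2)`. -/
abbrev GO (ε : FormType) (n : ℕ) :
    Subgroup ((Fin n → Fin 2 → ZMod 2) ≃ₗ[ZMod 2] (Fin n → Fin 2 → ZMod 2)) :=
  isometryGroup (stdForm ε n)

end Biextraspecial

open Biextraspecial

open Biextraspecial

namespace Biextraspecial

/-! ### Groups of exponent two -/

section ExponentTwo

/-! Choose `x` and `t` in `L` of orders three and two, let X be conjugation by `x`, and put E =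
C_Q(t). All irreducible sections of Q are natural modules, so X has no nontrivial fixed point on Q.
Hence X²a = (a · Xa)⁻¹, and the commutator map Q/Z × Q/Z → Z satisfies [Xa, b] = X²[a, b]
(`comm_X_left`). Every element of Q is uniquely e · Xf with e, f in E, so |E| = 2^(1+m), and the
product of two such elements is expressed by products and commutators taken in E
(`mul_X_mul_mul_X`). Thus Q with its L-action is recovered from E, and restriction is an isomorphism
C → Aut(E) (`restrictFixed_bijective`).

The centre of E is E ∩ Z, of order two, so E is extraspecial (of order two if m = 0). In a dent D
the involution `t` fixes a single nontrivial coset of Z, and this coset meets E. So e ↦ Z⟨e, Xe⟩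
identifies E/Z(E) with the dent space. Under it the product ef gives the diagonal dent, the squaring
map of E gives q, and its commutator map gives β. This is the usual quadratic form of an
extraspecial group.

What remains is the automorphism group of E. Every isometry of E/Z(E) lifts to E (`exists_lift`),
and an automorphism trivial on E/Z(E) is inner because the polar form is nondegenerate
(`exists_conj_of_map_eq`). So the kernel of the action is Inn(E) ≅ E/Z(E). The type ε comes from
splitting off hyperbolic planes (`exists_equivalent_stdForm`). For Out(G), Sylow's theorem and
C_G(x) = ⟨x⟩ show that every automorphism agrees modulo inner ones with one fixing `x` and `t`, and
that C contains no nontrivial inner automorphism. -/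

theorem mul_comm_of_sq_eq_one {H : Type*} [Group H] (h : ∀ a : H, a ^ 2 = 1) (a b : H) :
    a * b = b * a := by
  have inv : ∀ c : H, c⁻¹ = c := fun c => by
    rw [inv_eq_iff_mul_eq_one, ← sq, h]
  rw [← inv (a * b), mul_inv_rev, inv, inv]

/-- A group of exponent two is commutative. -/
abbrev commGroupOfSq {H : Type*} [Group H] (h : ∀ a : H, a ^ 2 = 1) : CommGroup H :=
  { ‹Group H› with mul_comm := mul_comm_of_sq_eq_one h }

/-- A commutative group of exponent two is a vector space over the field with two elements. -/
abbrev moduleOfSq {H : Type*} [CommGroup H] (h : ∀ a : H, a ^ 2 = 1) :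
    Module (ZMod 2) (Additive H) :=
  AddCommGroup.zmodModule (n := 2) fun x => by
    rw [← ofMul_toMul x, ← ofMul_pow, h, ofMul_one]

/-- The quotient by N is a vector space over the field with two elements, and linear functionals
separate its points. The kernel of the character is the index-two subgroup needed in `exists_lift`.
-/
theorem exists_hom_of_sq_mem {H : Type*} [Group H] (N : Subgroup H) [N.Normal]
    (hN : ∀ a, a ^ 2 ∈ N) (w : H) (hw : w ∉ N) :
    ∃ χ : H →* Multiplicative (ZMod 2),
      (∀ n ∈ N, χ n = 1) ∧ χ w = Multiplicative.ofAdd 1 := by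
  have hsq : ∀ a : H ⧸ N, a ^ 2 = 1 := by
    intro a
    obtain ⟨a, rfl⟩ := QuotientGroup.mk_surjective a
    rw [← QuotientGroup.mk_pow, QuotientGroup.eq_one_iff]
    exact hN a
  let : CommGroup (H ⧸ N) := commGroupOfSq hsq
  let : Module (ZMod 2) (Additive (H ⧸ N)) := moduleOfSq hsq
  have hne : Additive.ofMul (w : H ⧸ N) ≠ 0 := by
    intro h
    rw [ofMul_eq_zero, QuotientGroup.eq_one_iff] at h
    exact hw h
  have := mt (Module.forall_dual_apply_eq_zero_iff (ZMod 2) (Additive.ofMul (w : H ⧸ N))).1 hne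
  push Not at this
  obtain ⟨f, hf⟩ := this
  have h2 : ∀ c : ZMod 2, c ≠ 0 → c = 1 := by decide
  refine ⟨(AddMonoidHom.toMultiplicativeRight f.toAddMonoidHom).comp (QuotientGroup.mk' N), ?_, ?_⟩
  · intro n hn
    have : (n : H ⧸ N) = 1 := (QuotientGroup.eq_one_iff n).2 hn
    simp [this]
  · change Multiplicative.ofAdd (f (Additive.ofMul (w : H ⧸ N))) = _
    rw [h2 _ hf]

theorem nonempty_mulEquiv_of_sq_eq_one {H : Type*} [Group H] (h : ∀ a : H, a ^ 2 = 1)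
    (n : ℕ) (hn : Nat.card H = 2 ^ n) : Nonempty (H ≃* Multiplicative (Fin n → ZMod 2)) := by
  let : CommGroup H := commGroupOfSq h
  let : Module (ZMod 2) (Additive H) := moduleOfSq h
  have : Finite H := Nat.finite_of_card_ne_zero (by rw [hn]; positivity)
  have : Finite (Additive H) := this
  have : Module.Finite (ZMod 2) (Additive H) := Module.Finite.of_finite
  have hr : Module.finrank (ZMod 2) (Additive H) = n := by
    have := Module.natCard_eq_pow_finrank (K := ZMod 2) (V := Additive H)
    rw [Nat.card_zmod] at this
    change Nat.card H = _ at this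
    rw [hn] at this
    exact (Nat.pow_right_injective le_rfl this).symm
  have e : Additive H ≃ₗ[ZMod 2] (Fin n → ZMod 2) :=
    LinearEquiv.ofFinrankEq _ _ (by rw [hr, Module.finrank_fin_fun])
  exact ⟨AddEquiv.toMultiplicativeRight e.toAddEquiv⟩

end ExponentTwo

theorem exists_mulEquiv_of_ker_iff {A B C : Type*} [Group A] [Group B] [Group C]
    (f : A →* B) (g : A →* C) (hf : Function.Surjective f) (hg : Function.Surjective g)
    (h : ∀ a, f a = 1 ↔ g a = 1) : ∃ e : B ≃* C, ∀ a, e (f a) = g a := by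
  let k : B →* C := f.liftOfSurjective hf ⟨g, fun a ha => (h a).1 ha⟩
  have hk : ∀ a, k (f a) = g a := fun a =>
    MonoidHom.liftOfRightInverse_comp_apply f _ (Function.rightInverse_surjInv hf)
      ⟨g, fun a ha => (h a).1 ha⟩ a
  refine ⟨MulEquiv.ofBijective k ⟨?_, ?_⟩, hk⟩
  · rw [injective_iff_map_eq_one]
    intro b hb
    obtain ⟨a, rfl⟩ := hf b
    rwa [hk, ← h] at hb
  · intro c
    obtain ⟨a, rfl⟩ := hg c
    exact ⟨f a, hk a⟩

/-! ### Extraspecial groups -/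

open Classical in
/-- The indicator of the nontrivial elements of a group. -/
noncomputable def nontrivialIndicator {E : Type*} [Group E] (e : E) : ZMod 2 :=
  if e = 1 then 0 else 1

theorem nontrivialIndicator_eq_zero {E : Type*} [Group E] {e : E} :
    nontrivialIndicator e = 0 ↔ e = 1 := by
  unfold nontrivialIndicator
  split_ifs with h <;> simp [h]

@[simp] theorem nontrivialIndicator_one {E : Type*} [Group E] :
    nontrivialIndicator (1 : E) = 0 := nontrivialIndicator_eq_zero.2 rfl

theorem nontrivialIndicator_of_ne {E : Type*} [Group E] {e : E} (h : e ≠ 1) :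
    nontrivialIndicator e = 1 := if_neg h

theorem nontrivialIndicator_eq_iff {E F : Type*} [Group E] [Group F] {e : E} {f : F} :
    nontrivialIndicator e = nontrivialIndicator f ↔ (e = 1 ↔ f = 1) := by
  unfold nontrivialIndicator
  split_ifs with h h' h' <;> simp [h, h']

theorem nontrivialIndicator_map {E F : Type*} [Group E] [Group F] (α : E ≃* F) (e : E) :
    nontrivialIndicator (α e) = nontrivialIndicator e := by
  rw [nontrivialIndicator_eq_iff, EmbeddingLike.map_eq_one_iff]

/-- `p` is the quotient map of `E` onto a vector space over the field with two elements, with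
kernel the centre of `E`, which has order two and is generated by `z`. -/
structure IsExtraspecialQuotient {E W : Type*} [Group E] [AddCommGroup W] [Module (ZMod 2) W]
    (p : E →* Multiplicative W) (z : E) : Prop where
  surjective : Function.Surjective p
  ne_one : z ≠ 1
  map_eq_one : ∀ e, p e = 1 ↔ e = 1 ∨ e = z
  map_eq_one_iff_central : ∀ e, p e = 1 ↔ ∀ f, e * f = f * e

namespace IsExtraspecialQuotient

variable {E W : Type*} [Group E] [AddCommGroup W] [Module (ZMod 2) W]
  {p : E →* Multiplicative W} {z : E}

theorem mul_self_quotient (w : Multiplicative W) : w ^ 2 = 1 := by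
  rw [← ofAdd_toAdd w, ← ofAdd_nsmul, ZModModule.char_nsmul_eq_zero 2 w.toAdd, ofAdd_zero]

theorem map_sq (e : E) : p (e ^ 2) = 1 := by rw [map_pow, mul_self_quotient]

omit [Module (ZMod 2) W] in
theorem map_commutator (e f : E) : p (e * f * e⁻¹ * f⁻¹) = 1 := by
  simp only [map_mul, map_inv]
  rw [mul_comm (p e)]
  group

omit [Module (ZMod 2) W] in
theorem map_conj (u e : E) : p (MulAut.conj u e) = p e := by
  rw [MulAut.conj_apply]
  simp only [map_mul, map_inv]
  rw [mul_comm (p u)]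
  group

section

variable (h : IsExtraspecialQuotient p z)
include h

theorem map_z : p z = 1 := (h.map_eq_one z).2 (Or.inr rfl)

theorem z_sq : z * z = 1 := by
  have : p (z * z) = 1 := by rw [map_mul, h.map_z, one_mul]
  rcases (h.map_eq_one _).1 this with h1 | h1
  · exact h1
  · exact absurd (mul_eq_left.1 h1) h.ne_one

theorem central {c : E} (hc : p c = 1) (f : E) : c * f = f * c :=
  (h.map_eq_one_iff_central c).1 hc f

theorem sq_of_map_eq_one {c : E} (hc : p c = 1) : c ^ 2 = 1 := by
  rcases (h.map_eq_one c).1 hc with rfl | rfl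
  · exact one_pow 2
  · rw [sq, h.z_sq]

theorem indicator_mul {a b : E} (ha : p a = 1) (hb : p b = 1) :
    nontrivialIndicator (a * b) = nontrivialIndicator a + nontrivialIndicator b := by
  have h2 : (1 : ZMod 2) + 1 = 0 := by decide
  rcases (h.map_eq_one a).1 ha with rfl | rfl <;> rcases (h.map_eq_one b).1 hb with rfl | rfl <;>
    simp [h.z_sq, h2, nontrivialIndicator_of_ne h.ne_one]

theorem eq_of_indicator_eq {a b : E} (ha : p a = 1) (hb : p b = 1)
    (hab : nontrivialIndicator a = nontrivialIndicator b) : a = b := by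
  rw [nontrivialIndicator_eq_iff] at hab
  rcases (h.map_eq_one a).1 ha with rfl | rfl <;> rcases (h.map_eq_one b).1 hb with rfl | rfl <;>
    simp_all

theorem sq_congr {e f : E} (hef : p e = p f) : e ^ 2 = f ^ 2 := by
  have hc : p (e⁻¹ * f) = 1 := by rw [map_mul, map_inv, hef, inv_mul_cancel]
  have h1 : f = e * (e⁻¹ * f) := by group
  have h2 := h.sq_of_map_eq_one hc
  have h3 : Commute e (e⁻¹ * f) := (h.central hc e).symm
  calc e ^ 2 = e ^ 2 * (e⁻¹ * f) ^ 2 := by rw [h2, mul_one]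
    _ = (e * (e⁻¹ * f)) ^ 2 := (h3.mul_pow 2).symm
    _ = f ^ 2 := by rw [← h1]

/-- Squares are central, so (ef)² = [e, f] e² f²: the squaring map is quadratic with the commutator
as polar form. -/
theorem indicator_mul_sq (e f : E) :
    nontrivialIndicator ((e * f) ^ 2) = nontrivialIndicator (e ^ 2) +
      nontrivialIndicator (f ^ 2) + nontrivialIndicator (e * f * e⁻¹ * f⁻¹) := by
  have h1 : (e * f) ^ 2 = e * f * e⁻¹ * f⁻¹ * (e ^ 2 * f ^ 2) := by
    have := h.central (map_sq e) f
    calc (e * f) ^ 2 = e * f * e⁻¹ * f⁻¹ * ((f * e ^ 2) * f) := by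
          simp only [sq, mul_assoc, inv_mul_cancel_left]
      _ = e * f * e⁻¹ * f⁻¹ * ((e ^ 2 * f) * f) := by rw [this]
      _ = _ := by simp only [sq, mul_assoc]
  have h4 : p (e ^ 2 * f ^ 2) = 1 := by rw [map_mul, map_sq, map_sq, one_mul]
  rw [h1, h.indicator_mul (map_commutator e f) h4, h.indicator_mul (map_sq e) (map_sq f)]
  ring

theorem indicator_commutator_mul (e e' f : E) :
    nontrivialIndicator (e * e' * f * (e * e')⁻¹ * f⁻¹) =
      nontrivialIndicator (e * f * e⁻¹ * f⁻¹) + nontrivialIndicator (e' * f * e'⁻¹ * f⁻¹) := by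
  have h1 : e * e' * f * (e * e')⁻¹ * f⁻¹ =
      e' * f * e'⁻¹ * f⁻¹ * (e * f * e⁻¹ * f⁻¹) := by
    have := h.central (map_commutator e' f) e
    calc e * e' * f * (e * e')⁻¹ * f⁻¹ = (e * (e' * f * e'⁻¹ * f⁻¹)) * (f * e⁻¹ * f⁻¹) := by group
      _ = ((e' * f * e'⁻¹ * f⁻¹) * e) * (f * e⁻¹ * f⁻¹) := by rw [this]
      _ = _ := by group
  rw [h1, h.indicator_mul (map_commutator _ _) (map_commutator _ _), add_comm]

theorem exists_toAdd_eq (w : W) : ∃ e, (p e).toAdd = w := by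
  obtain ⟨e, he⟩ := h.surjective (Multiplicative.ofAdd w)
  exact ⟨e, by rw [he]; rfl⟩

/-- Squares depend only on the class modulo the centre, since a central factor squares to 1; so
squaring descends along any section of `p`. -/
theorem exists_quadraticForm : ∃ q : QuadraticForm (ZMod 2) W,
    (∀ e, q (p e).toAdd = nontrivialIndicator (e ^ 2)) ∧
    ∀ e f, QuadraticMap.polar q (p e).toAdd (p f).toAdd =
      nontrivialIndicator (e * f * e⁻¹ * f⁻¹) := by
  choose s hs using h.exists_toAdd_eq
  let F : W → ZMod 2 := fun w => nontrivialIndicator (s w ^ 2)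
  have hF : ∀ e, F (p e).toAdd = nontrivialIndicator (e ^ 2) := fun e => by
    change nontrivialIndicator (s _ ^ 2) = _
    rw [h.sq_congr (Multiplicative.toAdd.injective (hs (p e).toAdd))]
  have hadd : ∀ e f, (p e).toAdd + (p f).toAdd = (p (e * f)).toAdd := fun e f => by
    rw [map_mul, toAdd_mul]
  have hpol : ∀ e f, QuadraticMap.polar F (p e).toAdd (p f).toAdd =
      nontrivialIndicator (e * f * e⁻¹ * f⁻¹) := fun e f => by
    rw [QuadraticMap.polar, hadd, hF, hF, hF, h.indicator_mul_sq]
    ring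
  have hF0 : F 0 = 0 := by simpa using hF 1
  have hpol0 : ∀ y, QuadraticMap.polar F 0 y = 0 := fun y => by
    simp [QuadraticMap.polar, hF0]
  have h2 : ∀ a : ZMod 2, a = 0 ∨ a = 1 := by decide
  refine ⟨QuadraticMap.ofPolar F ?_ ?_ ?_, hF, hpol⟩
  · intro a x
    rcases h2 a with rfl | rfl <;> simp [hF0]
  · intro x x' y
    rw [← hs x, ← hs x', ← hs y, hadd, hpol, hpol, hpol, h.indicator_commutator_mul]
  · intro a x y
    rcases h2 a with rfl | rfl <;> simp [hpol0]

theorem map_apply_congr (α : MulAut E) {e f : E} (hef : p e = p f) : p (α e) = p (α f) := by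
  have hc : p (e⁻¹ * f) = 1 := by rw [map_mul, map_inv, hef, inv_mul_cancel]
  have : p (α (e⁻¹ * f)) = 1 := by
    rw [h.map_eq_one_iff_central]
    intro g
    obtain ⟨g, rfl⟩ := α.surjective g
    rw [← map_mul, ← map_mul, h.central hc]
  rw [map_mul, map_inv, map_mul, map_inv, inv_mul_eq_one] at this
  exact this

theorem exists_action : ∃ ρ : MulAut E →* (W ≃ₗ[ZMod 2] W),
    ∀ α e, ρ α (p e).toAdd = (p (α e)).toAdd := by
  choose s hs using h.exists_toAdd_eq
  let F : MulAut E → W → W := fun α w => (p (α (s w))).toAdd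
  have hF : ∀ α e, F α (p e).toAdd = (p (α e)).toAdd := fun α e => by
    change (p (α (s _))).toAdd = _
    rw [h.map_apply_congr α (Multiplicative.toAdd.injective (hs (p e).toAdd))]
  have hadd : ∀ e f, (p e).toAdd + (p f).toAdd = (p (e * f)).toAdd := fun e f => by
    rw [map_mul, toAdd_mul]
  have hFadd : ∀ α x y, F α (x + y) = F α x + F α y := fun α x y => by
    rw [← hs x, ← hs y, hadd, hF, hF, hF, hadd, map_mul]
  have hFmul : ∀ α β x, F (α * β) x = F α (F β x) := fun α β x => by
    rw [← hs x, hF, hF β]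
    exact (hF α _).symm
  have hFone : ∀ x, F 1 x = x := fun x => by
    rw [← hs x, hF]
    rfl
  let G : MulAut E → (W →ₗ[ZMod 2] W) := fun α =>
    AddMonoidHom.toZModLinearMap 2 (AddMonoidHom.mk' (F α) (hFadd α))
  refine ⟨MonoidHom.mk' (fun α => LinearEquiv.ofLinearMap (G α) (G α⁻¹) ?_ ?_) ?_, hF⟩
  · ext x
    change F α (F α⁻¹ x) = x
    rw [← hFmul, mul_inv_cancel, hFone]
  · ext x
    change F α⁻¹ (F α x) = x
    rw [← hFmul, inv_mul_cancel, hFone]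
  · intro α β
    ext x
    exact hFmul α β x

/-- The automorphism is found as its graph. In the group of pairs (e, f) lying over the graph of g,
the preimages are ambiguous by central factors; a character nontrivial on (z, 1) and on (1, z) has a
kernel meeting each fibre of either projection exactly once. -/
theorem exists_lift (g : W ≃ₗ[ZMod 2] W)
    (hg : ∀ e f, (p f).toAdd = g (p e).toAdd → (e ^ 2 = 1 ↔ f ^ 2 = 1)) :
    ∃ α : MulAut E, ∀ e, (p (α e)).toAdd = g (p e).toAdd := by
  let P : Subgroup (E × E) :=
    { carrier := {a | (p a.2).toAdd = g (p a.1).toAdd}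
      one_mem' := by simp
      mul_mem' := by
        intro a b ha hb
        simp only [Set.mem_ofPred_eq, Prod.fst_mul, Prod.snd_mul, map_mul, toAdd_mul, map_add] at *
        rw [ha, hb]
      inv_mem' := by
        intro a ha
        simp only [Set.mem_ofPred_eq, Prod.fst_inv, Prod.snd_inv, map_inv, toAdd_inv, map_neg] at *
        rw [ha] }
  have hP : ∀ a : E × E, a ∈ P ↔ (p a.2).toAdd = g (p a.1).toAdd := fun a => Iff.rfl
  let N : Subgroup P :=
    { carrier := {a | a.1.1 = a.1.2 ∧ p a.1.1 = 1}
      one_mem' := by simp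
      mul_mem' := by
        rintro a b ⟨ha, ha'⟩ ⟨hb, hb'⟩
        simp [← ha, ← hb, ha', hb']
      inv_mem' := by
        rintro a ⟨ha, ha'⟩
        simp [← ha, ha'] }
  have hN : N.Normal := by
    refine ⟨?_⟩
    rintro a ⟨ha, ha'⟩ b
    have h1 := h.central ha'
    have h2 : b * a * b⁻¹ = a := by
      rw [mul_inv_eq_iff_eq_mul]
      ext
      · exact (h1 _).symm
      · exact (ha ▸ h1 _).symm
    rw [h2]
    exact ⟨ha, ha'⟩
  -- This is where g being an isometry enters: both coordinates of a pair have the same square, so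
  -- P/N has exponent two.
  have hsq : ∀ a, a ^ 2 ∈ N := by
    intro a
    refine ⟨?_, map_sq a.1.1⟩
    refine h.eq_of_indicator_eq (map_sq a.1.1) (map_sq a.1.2) ?_
    rw [nontrivialIndicator_eq_iff]
    exact hg _ _ a.2
  have hz1 : ((z, 1) : E × E) ∈ P := by rw [hP]; simp [h.map_z]
  have h1z : ((1, z) : E × E) ∈ P := by rw [hP]; simp [h.map_z]
  obtain ⟨χ, hχN, hχ1⟩ := exists_hom_of_sq_mem N hsq ⟨_, hz1⟩ (fun hw => h.ne_one hw.1)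
  -- (z, z) lies in N, so χ takes the same value at (1, z) as at (z, 1).
  have hχ2 : χ ⟨_, h1z⟩ = Multiplicative.ofAdd 1 := by
    have : χ (⟨_, hz1⟩ * ⟨_, h1z⟩) = 1 := hχN _ ⟨by simp, by simpa using h.map_z⟩
    rw [map_mul, hχ1] at this
    rw [← inv_eq_of_mul_eq_one_right this]
    decide
  have hdich : ∀ c : Multiplicative (ZMod 2), c = 1 ∨ c * Multiplicative.ofAdd 1 = 1 := by decide
  have h10 : (Multiplicative.ofAdd 1 : Multiplicative (ZMod 2)) ≠ 1 := by decide
  -- Of the two preimages f and fz, exactly one gives a pair in the kernel of χ.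
  have hex : ∀ e, ∃ f, ∃ hf : (e, f) ∈ P, χ ⟨_, hf⟩ = 1 := by
    intro e
    obtain ⟨f, hf⟩ := h.exists_toAdd_eq (g (p e).toAdd)
    have hf : (e, f) ∈ P := hf
    rcases hdich (χ ⟨(e, f), hf⟩) with h1 | h1
    · exact ⟨f, hf, h1⟩
    · have hm : (e, f * z) ∈ P := by simpa using P.mul_mem hf h1z
      refine ⟨_, hm, ?_⟩
      rw [← h1, ← hχ2, ← map_mul]
      congr 1
      ext <;> simp
  have hex' : ∀ f, ∃ e, ∃ hf : (e, f) ∈ P, χ ⟨_, hf⟩ = 1 := by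
    intro f
    obtain ⟨e, he⟩ := h.exists_toAdd_eq (g.symm (p f).toAdd)
    have he : (e, f) ∈ P := by rw [hP, he, LinearEquiv.apply_symm_apply]
    rcases hdich (χ ⟨(e, f), he⟩) with h1 | h1
    · exact ⟨e, he, h1⟩
    · have hm : (e * z, f) ∈ P := by simpa using P.mul_mem he hz1
      refine ⟨_, hm, ?_⟩
      rw [← h1, ← hχ1, ← map_mul]
      congr 1
      ext <;> simp
  have huniq : ∀ f (hf : ((1 : E), f) ∈ P), χ ⟨_, hf⟩ = 1 → f = 1 := by
    intro f hf hχf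
    have h1 : p f = 1 := by
      rw [hP] at hf
      simpa using hf
    rcases (h.map_eq_one f).1 h1 with h2 | rfl
    · exact h2
    · exact absurd (hχ2.symm.trans hχf) h10
  have huniq' : ∀ e (he : (e, (1 : E)) ∈ P), χ ⟨_, he⟩ = 1 → e = 1 := by
    intro e he hχe
    have h1 : p e = 1 := by
      rw [hP] at he
      simpa using he.symm
    rcases (h.map_eq_one e).1 h1 with h2 | rfl
    · exact h2
    · exact absurd (hχ1.symm.trans hχe) h10
  choose a ha hχa using hex
  have key : ∀ e f (hf : (e, f) ∈ P), χ ⟨_, hf⟩ = 1 → a e = f := by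
    intro e f hf hχf
    have h1 : χ (⟨_, ha e⟩ * ⟨_, hf⟩⁻¹) = 1 := by rw [map_mul, map_inv, hχa, hχf]; simp
    have h2 : ((1 : E), a e * f⁻¹) ∈ P := by
      have := P.mul_mem (ha e) (P.inv_mem hf)
      simpa using this
    have h3 := huniq _ h2 (by
      rw [← h1]
      congr 1
      ext <;> simp)
    exact mul_inv_eq_one.1 h3
  have hmul : ∀ e e', a (e * e') = a e * a e' := by
    intro e e'
    refine key _ _ (P.mul_mem (ha e) (ha e')) ?_
    have : χ (⟨_, ha e⟩ * ⟨_, ha e'⟩) = 1 := by rw [map_mul, hχa, hχa, one_mul]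
    exact this
  refine ⟨MulEquiv.ofBijective (MonoidHom.mk' a hmul) ⟨?_, ?_⟩, ha⟩
  · rw [injective_iff_map_eq_one]
    intro e he
    change a e = 1 at he
    have h1 := ha e
    have h2 := hχa e
    simp only [he] at h1 h2
    exact huniq' e h1 h2
  · intro f
    obtain ⟨e, he, hχe⟩ := hex' f
    exact ⟨e, key e f he hχe⟩

/-- The map e ↦ e⁻¹α(e) takes central values and induces a linear functional on W. Since the polar
form is nondegenerate and W is finite, this functional is e ↦ [u, e] for some u, and then α is
conjugation by u. -/
theorem exists_conj_of_map_eq [Finite W] (α : MulAut E) (hα : ∀ e, p (α e) = p e) :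
    ∃ u, α = MulAut.conj u := by
  obtain ⟨q, -, hpol⟩ := h.exists_quadraticForm
  have hc : ∀ e, p (e⁻¹ * α e) = 1 := fun e => by rw [map_mul, map_inv, hα, inv_mul_cancel]
  have hαz : α z = z := by
    rcases (h.map_eq_one _).1 ((hα z).trans h.map_z) with h1 | h1
    · rw [EmbeddingLike.map_eq_one_iff] at h1
      exact absurd h1 h.ne_one
    · exact h1
  choose s hs using h.exists_toAdd_eq
  have hs' : ∀ e, ∃ c, (c = 1 ∨ c = z) ∧ s (p e).toAdd = e * c := by
    intro e
    refine ⟨e⁻¹ * s (p e).toAdd, ?_, by group⟩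
    rw [← h.map_eq_one, map_mul, Multiplicative.toAdd.injective (hs (p e).toAdd), map_inv,
      inv_mul_cancel]
  let lam : W → ZMod 2 := fun w => nontrivialIndicator ((s w)⁻¹ * α (s w))
  have hlam : ∀ e, lam (p e).toAdd = nontrivialIndicator (e⁻¹ * α e) := by
    intro e
    obtain ⟨c, hcz, hsc⟩ := hs' e
    have hαc : α c = c := by rcases hcz with rfl | rfl <;> simp [hαz]
    have hcp : p c = 1 := (h.map_eq_one c).2 hcz
    change nontrivialIndicator ((s _)⁻¹ * α (s _)) = _
    rw [hsc, map_mul, hαc, mul_inv_rev]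
    congr 1
    have := h.central hcp (e⁻¹ * α e)
    calc c⁻¹ * e⁻¹ * (α e * c) = c⁻¹ * ((e⁻¹ * α e) * c) := by group
      _ = c⁻¹ * (c * (e⁻¹ * α e)) := by rw [this]
      _ = _ := by group
  have hlam_add : ∀ x y, lam (x + y) = lam x + lam y := by
    intro x y
    obtain ⟨e, rfl⟩ := h.exists_toAdd_eq x
    obtain ⟨f, rfl⟩ := h.exists_toAdd_eq y
    rw [← toAdd_mul, ← map_mul, hlam, hlam, hlam, ← h.indicator_mul (hc e) (hc f)]
    congr 1
    have := h.central (hc e) f⁻¹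
    calc (e * f)⁻¹ * α (e * f) = f⁻¹ * (e⁻¹ * α e) * α f := by rw [map_mul]; group
      _ = (e⁻¹ * α e) * f⁻¹ * α f := by rw [this]
      _ = _ := by group
  let Λ : Module.Dual (ZMod 2) W :=
    AddMonoidHom.toZModLinearMap 2 (AddMonoidHom.mk' lam hlam_add)
  have : Module.Finite (ZMod 2) W := Module.Finite.of_finite
  -- The radical of the polar form is the image of the centre of E, which is zero.
  have hinj : Function.Injective (q.polarBilin : W →ₗ[ZMod 2] Module.Dual (ZMod 2) W) := by
    rw [← LinearMap.ker_eq_bot, LinearMap.ker_eq_bot']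
    intro w hw
    obtain ⟨e, rfl⟩ := h.exists_toAdd_eq w
    rw [toAdd_eq_zero, h.map_eq_one_iff_central]
    intro f
    have h1 := LinearMap.congr_fun hw (p f).toAdd
    rw [QuadraticMap.polarBilin_apply_apply, hpol, LinearMap.zero_apply,
      nontrivialIndicator_eq_zero, mul_inv_eq_one, mul_inv_eq_iff_eq_mul] at h1
    exact h1
  obtain ⟨w, hw⟩ := (LinearMap.injective_iff_surjective_of_finrank_eq_finrank
    (Subspace.dual_finrank_eq (K := ZMod 2) (V := W)).symm).1 hinj Λ
  obtain ⟨u, rfl⟩ := h.exists_toAdd_eq w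
  refine ⟨u, ?_⟩
  ext e
  have h1 := LinearMap.congr_fun hw (p e).toAdd
  rw [QuadraticMap.polarBilin_apply_apply, hpol] at h1
  have h2 := h.eq_of_indicator_eq (map_commutator u e) (hc e) (h1.trans (hlam e))
  rw [MulAut.conj_apply]
  have h3 := h.central (hc e) e
  rw [mul_inv_eq_iff_eq_mul] at h2
  rw [h2, h3]
  group

theorem conj_eq_one (u : E) : MulAut.conj u = 1 ↔ p u = 1 := by
  rw [h.map_eq_one_iff_central, MulEquiv.ext_iff]
  refine forall_congr' fun f => ?_
  rw [MulAut.conj_apply, MulAut.one_apply, mul_inv_eq_iff_eq_mul]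

end

end IsExtraspecialQuotient

/-! ### Classification of nondegenerate quadratic forms over the field with two elements -/

section QuadraticForms

theorem zmod_two_eq_zero_or_one (a : ZMod 2) : a = 0 ∨ a = 1 := by
  revert a
  decide

theorem zmod_two_ne_zero {a : ZMod 2} (h : a ≠ 0) : a = 1 :=
  (zmod_two_eq_zero_or_one a).resolve_left h

/-- The plane added in passing from `stdForm ε n` to `stdForm ε (n + 1)`. -/
def stdPlane (ε : FormType) (n : ℕ) : QuadraticForm (ZMod 2) (Fin 2 → ZMod 2) :=
  match ε with
  | .plus => hyperbolicPlane
  | .minus => if n = 0 then anisotropicPlane else hyperbolicPlane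

/-- Splitting off the last coordinate. -/
def initLastEquiv (M : Type*) [AddCommGroup M] [Module (ZMod 2) M] (n : ℕ) :
    (Fin (n + 1) → M) ≃ₗ[ZMod 2] M × (Fin n → M) where
  toFun f := (f (Fin.last n), Fin.init f)
  map_add' _ _ := rfl
  map_smul' _ _ := rfl
  invFun x := Fin.snoc x.2 x.1
  left_inv f := Fin.snoc_init_self f
  right_inv x := by
    ext <;> simp

theorem stdForm_apply (ε : FormType) (n : ℕ) (f : Fin n → Fin 2 → ZMod 2) :
    stdForm ε n f = ∑ i, stdPlane ε i.val (f i) := by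
  rw [stdForm, QuadraticMap.pi_apply]
  rfl

/-- For type minus the anisotropic plane has index 0, so removing the last coordinate keeps the type
as long as planes remain. -/
theorem stdForm_succ (ε : FormType) (n : ℕ) :
    QuadraticMap.Equivalent ((stdPlane ε n).prod (stdForm ε n)) (stdForm ε (n + 1)) := by
  refine QuadraticMap.Equivalent.symm ⟨⟨initLastEquiv _ n, ?_⟩⟩
  intro f
  change QuadraticMap.prod _ _ (f (Fin.last n), Fin.init f) = _
  rw [QuadraticMap.prod_apply, stdForm_apply, stdForm_apply, Fin.sum_univ_castSucc, add_comm]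
  rfl

theorem hyperbolicPlane_apply (c : Fin 2 → ZMod 2) : hyperbolicPlane c = c 0 * c 1 := rfl

theorem anisotropicPlane_apply (c : Fin 2 → ZMod 2) :
    anisotropicPlane c = c 0 * c 0 + c 0 * c 1 + c 1 * c 1 := rfl

variable {V : Type*} [AddCommGroup V] [Module (ZMod 2) V]

theorem polar_self_eq_zero (q : QuadraticForm (ZMod 2) V) (v : V) :
    QuadraticMap.polar q v v = 0 := by
  rw [QuadraticMap.polar_self]
  exact ZModModule.char_nsmul_eq_zero 2 _

theorem map_add_eq (q : QuadraticForm (ZMod 2) V) (v w : V) :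
    q (v + w) = q v + q w + QuadraticMap.polar q v w := by
  rw [QuadraticMap.polar]
  ring

/-- The orthogonal complement of the plane spanned by `u` and `v`. -/
def planeComplement (q : QuadraticForm (ZMod 2) V) (u v : V) : Submodule (ZMod 2) V :=
  LinearMap.ker (q.polarBilin u) ⊓ LinearMap.ker (q.polarBilin v)

theorem mem_planeComplement {q : QuadraticForm (ZMod 2) V} {u v w : V} :
    w ∈ planeComplement q u v ↔ QuadraticMap.polar q u w = 0 ∧ QuadraticMap.polar q v w = 0 :=
  Iff.rfl

theorem exists_plane_decomposition (q : QuadraticForm (ZMod 2) V) {u v : V}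
    (huv : QuadraticMap.polar q u v = 1) :
    ∃ e : ((Fin 2 → ZMod 2) × planeComplement q u v) ≃ₗ[ZMod 2] V,
      ∀ c w, e (c, w) = c 0 • u + c 1 • v + w := by
  let f : ((Fin 2 → ZMod 2) × planeComplement q u v) →ₗ[ZMod 2] V :=
    { toFun := fun x => x.1 0 • u + x.1 1 • v + x.2
      map_add' := by
        intro x y
        simp only [Prod.fst_add, Prod.snd_add, Pi.add_apply, add_smul, Submodule.coe_add]
        abel
      map_smul' := by
        intro a x
        simp [mul_smul, smul_add] }
  have hvu : QuadraticMap.polar q v u = 1 := by rw [QuadraticMap.polar_comm, huv]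
  refine ⟨LinearEquiv.ofBijective f ⟨?_, ?_⟩, fun _ _ => rfl⟩
  · rw [← LinearMap.ker_eq_bot, LinearMap.ker_eq_bot']
    rintro ⟨c, w, hw⟩ h
    have h0 : c 0 • u + c 1 • v + w = 0 := h
    obtain ⟨hwu, hwv⟩ := mem_planeComplement.1 hw
    have h1 : QuadraticMap.polar q u (c 0 • u + c 1 • v + w) = 0 := by rw [h0]; simp
    have h2 : QuadraticMap.polar q v (c 0 • u + c 1 • v + w) = 0 := by rw [h0]; simp
    rw [QuadraticMap.polar_add_right, QuadraticMap.polar_add_right, QuadraticMap.polar_smul_right,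
      QuadraticMap.polar_smul_right, polar_self_eq_zero, huv, hwu] at h1
    rw [QuadraticMap.polar_add_right, QuadraticMap.polar_add_right, QuadraticMap.polar_smul_right,
      QuadraticMap.polar_smul_right, polar_self_eq_zero, hvu, hwv] at h2
    have h1 : c 1 = 0 := by simpa using h1
    have h2 : c 0 = 0 := by simpa using h2
    have h3 : w = 0 := by simpa [h1, h2] using h0
    ext i
    · fin_cases i <;> simp [h1, h2]
    · exact h3
  · intro x
    have h2 : ∀ y : V, y + y = 0 := fun y => ZModModule.add_self y
    -- Since u and v pair to 1 and each pairs to 0 with itself, the coefficient of u in x is the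
    -- value of the form at (v, x), and that of v the value at (u, x). Signs do not matter in
    -- characteristic two.
    refine ⟨(![QuadraticMap.polar q v x, QuadraticMap.polar q u x],
      ⟨x + QuadraticMap.polar q v x • u + QuadraticMap.polar q u x • v, ?_⟩), ?_⟩
    · rw [mem_planeComplement]
      simp only [QuadraticMap.polar_add_right, QuadraticMap.polar_smul_right, polar_self_eq_zero,
        huv, hvu, smul_eq_mul, mul_one, mul_zero, add_zero]
      exact ⟨ZModModule.add_self _, ZModModule.add_self _⟩
    · change QuadraticMap.polar q v x • u + QuadraticMap.polar q u x • v +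
        (x + QuadraticMap.polar q v x • u + QuadraticMap.polar q u x • v) = x
      calc _ = x + (QuadraticMap.polar q v x • u + QuadraticMap.polar q v x • u) +
            (QuadraticMap.polar q u x • v + QuadraticMap.polar q u x • v) := by abel
        _ = x := by rw [h2, h2, add_zero, add_zero]

theorem equivalent_prod_planeComplement (q : QuadraticForm (ZMod 2) V) {u v : V}
    (huv : QuadraticMap.polar q u v = 1) (P : QuadraticForm (ZMod 2) (Fin 2 → ZMod 2))
    (hP : ∀ c, P c = c 0 * c 0 * q u + c 0 * c 1 + c 1 * c 1 * q v) :
    QuadraticMap.Equivalent q (P.prod (q.comp (planeComplement q u v).subtype)) := by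
  obtain ⟨e, he⟩ := exists_plane_decomposition q huv
  refine QuadraticMap.Equivalent.symm ⟨⟨e, ?_⟩⟩
  rintro ⟨c, w⟩
  obtain ⟨hwu, hwv⟩ := mem_planeComplement.1 w.2
  change q (e (c, w)) = _
  rw [he, QuadraticMap.prod_apply, hP, map_add_eq, map_add_eq, QuadraticMap.map_smul,
    QuadraticMap.map_smul, QuadraticMap.polar_add_left, QuadraticMap.polar_smul_left,
    QuadraticMap.polar_smul_left, QuadraticMap.polar_smul_left, QuadraticMap.polar_smul_right,
    huv, hwu, hwv]
  simp only [smul_eq_mul, QuadraticMap.comp_apply, Submodule.subtype_apply]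
  ring

theorem nondegenerate_planeComplement (q : QuadraticForm (ZMod 2) V) {u v : V}
    (huv : QuadraticMap.polar q u v = 1)
    (hq : ∀ x, (∀ y, QuadraticMap.polar q x y = 0) → x = 0) (x : planeComplement q u v)
    (hx : ∀ y, QuadraticMap.polar (q.comp (planeComplement q u v).subtype) x y = 0) : x = 0 := by
  obtain ⟨e, he⟩ := exists_plane_decomposition q huv
  obtain ⟨hxu, hxv⟩ := mem_planeComplement.1 x.2
  apply Subtype.ext
  refine hq _ fun y => ?_
  obtain ⟨⟨c, w⟩, rfl⟩ := e.surjective y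
  have h1 : QuadraticMap.polar q x w = 0 := by
    rw [← hx w]
    rfl
  rw [he, QuadraticMap.polar_add_right, QuadraticMap.polar_add_right,
    QuadraticMap.polar_smul_right, QuadraticMap.polar_smul_right, QuadraticMap.polar_comm q _ u,
    QuadraticMap.polar_comm q _ v, hxu, hxv, h1]
  simp

theorem equivalent_stdForm_zero [Subsingleton V] (q : QuadraticForm (ZMod 2) V) (ε : FormType) :
    QuadraticMap.Equivalent q (stdForm ε 0) := by
  refine ⟨⟨⟨⟨⟨fun _ => 0, by simp⟩, by simp⟩, fun _ => 0, fun _ => Subsingleton.elim _ _,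
    fun _ => Subsingleton.elim _ _⟩, fun x => ?_⟩⟩
  rw [Subsingleton.elim x 0]
  exact (QuadraticMap.map_zero _).trans (QuadraticMap.map_zero _).symm

end QuadraticForms

/-- A nonzero singular vector lies in a hyperbolic plane, which splits off, and induction applies to
its complement. Without such a vector the space is zero or an anisotropic plane: a nonzero w
orthogonal to u and v would give the singular vector u + w. -/
theorem exists_equivalent_stdForm.{u} (d : ℕ) : ∀ (V : Type u) [AddCommGroup V] [Module (ZMod 2) V]
    [Module.Finite (ZMod 2) V] (q : QuadraticForm (ZMod 2) V), Module.finrank (ZMod 2) V = d →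
    (∀ x, (∀ y, QuadraticMap.polar q x y = 0) → x = 0) →
    ∃ (ε : FormType) (n : ℕ), d = 2 * n ∧ QuadraticMap.Equivalent q (stdForm ε n) := by
  induction d using Nat.strong_induction_on with
  | _ d ih =>
    intro V _ _ _ q hd hq
    rcases subsingleton_or_nontrivial V with hV | hV
    · exact ⟨.plus, 0, by rw [← hd, Module.finrank_zero_of_subsingleton],
        equivalent_stdForm_zero q _⟩
    have hpair : ∀ u : V, u ≠ 0 → ∃ v, QuadraticMap.polar q u v = 1 := by
      intro u hu
      by_contra! h
      exact hu (hq u fun y => by_contra fun hy => h y (zmod_two_ne_zero hy))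
    have hdim : ∀ {u v : V}, QuadraticMap.polar q u v = 1 →
        d = 2 + Module.finrank (ZMod 2) (planeComplement q u v) := by
      intro u v huv
      obtain ⟨e, -⟩ := exists_plane_decomposition q huv
      rw [← hd, ← e.finrank_eq, Module.finrank_prod, Module.finrank_fin_fun]
    by_cases hs : ∃ u : V, u ≠ 0 ∧ q u = 0
    · obtain ⟨u, hu, hqu⟩ := hs
      obtain ⟨v, huv, hqv⟩ : ∃ v, QuadraticMap.polar q u v = 1 ∧ q v = 0 := by
        obtain ⟨v, huv⟩ := hpair u hu
        rcases zmod_two_eq_zero_or_one (q v) with hqv | hqv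
        · exact ⟨v, huv, hqv⟩
        · refine ⟨v + u, ?_, ?_⟩
          · rw [QuadraticMap.polar_add_right, polar_self_eq_zero, huv, add_zero]
          · rw [map_add_eq, QuadraticMap.polar_comm, huv, hqu, hqv]
            decide
      have hfr := hdim huv
      obtain ⟨ε, n, hn, heq⟩ := ih _ (by omega) (planeComplement q u v)
        (q.comp (planeComplement q u v).subtype) rfl (nondegenerate_planeComplement q huv hq)
      have hmain : QuadraticMap.Equivalent q (hyperbolicPlane.prod (stdForm ε n)) :=
        (equivalent_prod_planeComplement q huv hyperbolicPlane fun c => by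
          rw [hyperbolicPlane_apply, hqu, hqv]; ring).trans
          (QuadraticMap.Equivalent.prod (QuadraticMap.Equivalent.refl _) heq)
      -- If the complement is zero its type is arbitrary and must be taken to be plus, since for
      -- type minus the first plane would be anisotropic. Otherwise the added plane is hyperbolic
      -- for either type.
      rcases n with _ | n
      · refine ⟨.plus, 1, by omega, hmain.trans (QuadraticMap.Equivalent.trans
          (QuadraticMap.Equivalent.prod (QuadraticMap.Equivalent.refl _)
            (equivalent_stdForm_zero _ .plus)) (stdForm_succ .plus 0))⟩
      · refine ⟨ε, n + 2, by omega, hmain.trans ?_⟩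
        convert stdForm_succ ε (n + 1) using 2
        cases ε <;> simp [stdPlane]
    · push Not at hs
      obtain ⟨u, hu⟩ := exists_ne (0 : V)
      obtain ⟨v, huv⟩ := hpair u hu
      have hv : v ≠ 0 := by
        rintro rfl
        simp at huv
      have hqu := zmod_two_ne_zero (hs u hu)
      have hqv := zmod_two_ne_zero (hs v hv)
      have hsub : Subsingleton (planeComplement q u v) := by
        refine subsingleton_of_forall_eq 0 fun w => ?_
        by_contra hw
        obtain ⟨hwu, hwv⟩ := mem_planeComplement.1 w.2
        have hqw := zmod_two_ne_zero (hs w (by simpa using hw))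
        refine hs (u + w) (fun h0 => ?_) ?_
        · have h1 : QuadraticMap.polar q v (u + w) = 0 := by rw [h0]; simp
          rw [QuadraticMap.polar_add_right, QuadraticMap.polar_comm, huv, hwv] at h1
          simp at h1
        · rw [map_add_eq, hqu, hqw, hwu]
          decide
      refine ⟨.minus, 1, ?_, ?_⟩
      · rw [hdim huv, Module.finrank_zero_of_subsingleton]
      · refine (equivalent_prod_planeComplement q huv anisotropicPlane fun c => ?_).trans
          ((QuadraticMap.Equivalent.prod (QuadraticMap.Equivalent.refl _)
            (equivalent_stdForm_zero _ .minus)).trans (stdForm_succ .minus 0))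
        rw [anisotropicPlane_apply, hqu, hqv]
        ring

/-! ### Two-groups with a fixed-point-free action of `S₃` -/

/-- `X` and `T` generate an action of `S₃` on `P`, the element `X` of order three acts without
fixed points, `P` has elementary abelian central quotient, and the centre of `P` is elementary
abelian and contains exactly one involution fixed by `T`. -/
structure IsFixedPointFreeAction {P : Type*} [Group P] (X T : MulAut P) : Prop where
  X_cube : ∀ a, X (X (X a)) = a
  T_sq : ∀ a, T (T a) = a
  T_X : ∀ a, T (X a) = X (X (T a))
  eq_one_of_X : ∀ a, X a = a → a = 1
  commutator_mem : ∀ a b : P, a * b * a⁻¹ * b⁻¹ ∈ Subgroup.center P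
  sq_mem : ∀ a : P, a ^ 2 ∈ Subgroup.center P
  center_sq : ∀ c ∈ Subgroup.center P, c ^ 2 = 1
  exists_fixed : ∃ z ∈ Subgroup.center P, z ≠ 1 ∧ T z = z ∧
    ∀ c ∈ Subgroup.center P, T c = c → c = 1 ∨ c = z

/-- The subgroup of fixed points of an automorphism. -/
def fixedSubgroup {P : Type*} [Group P] (T : MulAut P) : Subgroup P where
  carrier := {a | T a = a}
  one_mem' := map_one T
  mul_mem' {a b} ha hb := by
    change T (a * b) = a * b
    rw [map_mul, ha, hb]
  inv_mem' {a} ha := by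
    change T a⁻¹ = a⁻¹
    rw [map_inv, ha]

theorem mem_fixedSubgroup {P : Type*} [Group P] {T : MulAut P} {a : P} :
    a ∈ fixedSubgroup T ↔ T a = a := Iff.rfl

/-- The commutator of two elements. -/
def comm {P : Type*} [Group P] (a b : P) : P := a * b * a⁻¹ * b⁻¹

theorem comm_mul_swap {P : Type*} [Group P] (a b : P) : a * b = comm a b * (b * a) := by
  unfold comm
  group

theorem comm_eq_one {P : Type*} [Group P] {a b : P} : comm a b = 1 ↔ Commute a b := by
  rw [comm, mul_inv_eq_one, mul_inv_eq_iff_eq_mul]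
  rfl

theorem map_comm {P R : Type*} [Group P] [Group R] (f : P ≃* R) (a b : P) :
    f (comm a b) = comm (f a) (f b) := by
  simp [comm]

theorem mem_center_comm {P : Type*} [Group P] {c : P} (hc : c ∈ Subgroup.center P) (a : P) :
    c * a = a * c := (Subgroup.mem_center_iff.1 hc a).symm

theorem map_mem_center {P : Type*} [Group P] (f : MulAut P) {c : P}
    (hc : c ∈ Subgroup.center P) : f c ∈ Subgroup.center P := by
  rw [Subgroup.mem_center_iff]
  intro g
  obtain ⟨g, rfl⟩ := f.surjective g
  rw [← map_mul, ← map_mul, mem_center_comm hc]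

namespace IsFixedPointFreeAction

variable {P : Type*} [Group P] {X T : MulAut P} (h : IsFixedPointFreeAction X T)
include h

theorem center_inv {c : P} (hc : c ∈ Subgroup.center P) : c⁻¹ = c := by
  rw [inv_eq_iff_mul_eq_one, ← sq, h.center_sq c hc]

theorem comm_mem (a b : P) : comm a b ∈ Subgroup.center P := h.commutator_mem a b

theorem comm_mul_left (a a' b : P) : comm (a * a') b = comm a b * comm a' b := by
  have h1 := mem_center_comm (h.comm_mem a' b) a
  have h2 := mem_center_comm (h.comm_mem a' b) (comm a b)
  rw [← h2]
  unfold comm at *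
  calc a * a' * b * (a * a')⁻¹ * b⁻¹
      = (a * (a' * b * a'⁻¹ * b⁻¹)) * (b * a⁻¹ * b⁻¹) := by group
    _ = ((a' * b * a'⁻¹ * b⁻¹) * a) * (b * a⁻¹ * b⁻¹) := by rw [h1]
    _ = _ := by group

theorem comm_symm (a b : P) : comm a b = comm b a := by
  rw [← h.center_inv (h.comm_mem b a)]
  unfold comm
  group

theorem comm_mul_right (a b b' : P) : comm a (b * b') = comm a b * comm a b' := by
  rw [h.comm_symm, h.comm_mul_left, h.comm_symm b, h.comm_symm b']

theorem comm_inv_left (a b : P) : comm a⁻¹ b = comm a b := by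
  have h1 : comm a⁻¹ b * comm a b = 1 := by
    rw [← h.comm_mul_left]
    simp [comm]
  rw [← inv_eq_of_mul_eq_one_left h1, h.center_inv (h.comm_mem _ _)]

theorem comm_inv_right (a b : P) : comm a b⁻¹ = comm a b := by
  rw [h.comm_symm, h.comm_inv_left, h.comm_symm]

variable [Finite P]

/-- On a finite group the map b ↦ b⁻¹ · Xb is injective when X has no nontrivial fixed point, hence
surjective. The product over the orbit of an element b⁻¹ · Xb telescopes. -/
theorem norm_eq_one (a : P) : a * X a * X (X a) = 1 := by
  have hinj : Function.Injective fun b : P => b⁻¹ * X b := by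
    intro b c hbc
    have h1 : X (b * c⁻¹) = b * c⁻¹ := by
      rw [map_mul, map_inv]
      have h2 : X b = b * (c⁻¹ * X c) := by
        rw [← show b⁻¹ * X b = c⁻¹ * X c from hbc, mul_inv_cancel_left]
      rw [h2]
      group
    exact mul_inv_eq_one.1 (h.eq_one_of_X _ h1)
  obtain ⟨b, rfl⟩ := Finite.surjective_of_injective hinj a
  simp only [map_mul, map_inv, h.X_cube]
  group

theorem X_X (a : P) : X (X a) = (X a)⁻¹ * a⁻¹ := by
  rw [← mul_inv_rev, eq_inv_iff_mul_eq_one, mul_eq_one_iff_inv_eq, inv_eq_iff_mul_eq_one]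
  have := h.norm_eq_one (X (X a))
  rw [h.X_cube] at this
  rw [mul_eq_one_iff_inv_eq, inv_eq_iff_mul_eq_one] at *
  rw [← this, mul_assoc]

theorem X_X_center {c : P} (hc : c ∈ Subgroup.center P) : X (X c) = c * X c := by
  rw [h.X_X, ← mul_inv_rev, h.center_inv (Subgroup.mul_mem _ hc (map_mem_center X hc))]

/-- X makes P/Z and Z into spaces over the field with four elements, and this says that the
commutator map is conjugate-linear in each variable. With c = [a, b], expanding X²c = [a · Xa, b ·
Xb] and comparing with X²c = c · Xc gives [a, Xb] = [Xa, b]. For d = [Xa, b] this yields Xd = d ·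
Xc, so X²d = Xc and d = X²c. -/
theorem comm_X_left (a b : P) : comm (X a) b = X (X (comm a b)) := by
  have hcc := h.comm_mem
  have hX : ∀ a b, X (comm a b) = comm (X a) (X b) := fun a b => map_comm X a b
  have h1 : comm a (X b) = comm (X a) b := by
    have e1 : X (X (comm a b)) = comm (a * X a) (b * X b) := by
      rw [hX, hX, h.X_X, h.X_X, ← mul_inv_rev, ← mul_inv_rev, h.comm_inv_left, h.comm_inv_right]
    rw [h.comm_mul_left, h.comm_mul_right, h.comm_mul_right, h.X_X_center (hcc a b), hX] at e1
    have e2 : comm a b * comm a (X b) * (comm (X a) b * comm (X a) (X b)) =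
        comm a b * (comm a (X b) * comm (X a) b) * comm (X a) (X b) := by group
    rw [e2, mul_left_inj, left_eq_mul] at e1
    rw [mul_eq_one_iff_eq_inv.1 e1, h.center_inv (hcc _ _)]
  have h2 : X (comm (X a) b) = comm (X a) b * X (comm a b) := by
    conv_lhs => rw [← h1, hX, h.X_X, ← mul_inv_rev, h.comm_inv_right, h.comm_mul_right]
    rw [hX]
  have h3 := h.X_X_center (hcc (X a) b)
  rw [h2, ← mul_assoc, ← sq, h.center_sq _ (hcc _ _), one_mul] at h3
  rw [map_mul, h2, mul_assoc] at h3
  have h4 : X (comm a b) = X (X (comm (X a) b)) := by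
    rw [h.X_X_center (hcc (X a) b), h2, ← mul_assoc, ← sq, h.center_sq _ (hcc _ _), one_mul]
  rw [h4, h.X_cube]

theorem commute_X_left {a b : P} (hab : Commute a b) : Commute (X a) b := by
  rw [← comm_eq_one, h.comm_X_left, comm_eq_one.2 hab, map_one, map_one]

theorem commute_X_right {a b : P} (hab : Commute a b) : Commute a (X b) :=
  (h.commute_X_left hab.symm).symm

/-! #### The decomposition of `P` as a product of two copies of the fixed points of `T` -/

theorem exists_decomposition (a : P) :
    ∃ e ∈ fixedSubgroup T, ∃ f ∈ fixedSubgroup T, a = e * X f := by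
  have hy : ∃ y, T a = a * y := ⟨a⁻¹ * T a, by group⟩
  obtain ⟨y, hy⟩ := hy
  have hTy : T y = y⁻¹ := by
    have h1 : T (T a) = T (a * y) := by rw [hy]
    rw [h.T_sq, map_mul, hy, mul_assoc, left_eq_mul] at h1
    exact eq_inv_of_mul_eq_one_right h1
  have hs := h.sq_mem y
  have hXs := map_mem_center X hs
  have hXXs := h.X_X_center hs
  -- If a = e · Xf, then y = (Xf)⁻¹ · X²f = f⁻¹ X(f²), because f and Xf commute and squares are
  -- central of order at most two. Then y² = f², so f = y⁻¹ X(y²).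
  have hf : T (y⁻¹ * X (y ^ 2)) = y⁻¹ * X (y ^ 2) := by
    have h1 : T (y ^ 2) = y ^ 2 := by rw [map_pow, hTy, inv_pow, h.center_inv hs]
    rw [map_mul, map_inv, hTy, h.T_X, h1, hXXs, inv_inv, ← mul_assoc, ← pow_succ']
    congr 1
    have h2 : y ^ 4 = 1 := by
      rw [show 4 = 2 * 2 from rfl, pow_mul, h.center_sq _ hs]
    rw [eq_inv_iff_mul_eq_one, ← pow_succ]
    exact h2
  refine ⟨a * (X (y⁻¹ * X (y ^ 2)))⁻¹, ?_, _, hf, by group⟩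
  have hsq : X (y⁻¹ * X (y ^ 2)) ^ 2 = X (y ^ 2) := by
    have hc : Commute y⁻¹ (X (y ^ 2)) := (mem_center_comm hXs _).symm
    rw [← map_pow, hc.mul_pow, h.center_sq _ hXs, mul_one, inv_pow, h.center_inv hs]
  have h3 : X (X (y⁻¹ * X (y ^ 2))) = X (y⁻¹ * X (y ^ 2)) * y := by
    rw [h.X_X, inv_mul_eq_iff_eq_mul, ← mul_assoc, ← sq, hsq, mul_inv_rev, h.center_inv hXs,
      inv_inv]
  rw [mem_fixedSubgroup, map_mul, map_inv, h.T_X, hf, hy, h3]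
  group

omit [Finite P] in
theorem eq_one_of_mem_of_X_mem {e : P} (he : e ∈ fixedSubgroup T)
    (hXe : X e ∈ fixedSubgroup T) : e = 1 := by
  rw [mem_fixedSubgroup] at he hXe
  rw [h.T_X, he] at hXe
  exact h.eq_one_of_X e (X.injective hXe)

omit [Finite P] in
theorem decomposition_unique {e f e' f' : P} (he : e ∈ fixedSubgroup T)
    (hf : f ∈ fixedSubgroup T) (he' : e' ∈ fixedSubgroup T) (hf' : f' ∈ fixedSubgroup T)
    (heq : e * X f = e' * X f') : e = e' ∧ f = f' := by
  have h1 : e'⁻¹ * e = X (f' * f⁻¹) := by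
    rw [map_mul, map_inv, inv_mul_eq_iff_eq_mul, ← mul_assoc, ← heq]
    group
  have h2 : f' * f⁻¹ = 1 := by
    refine h.eq_one_of_mem_of_X_mem (Subgroup.mul_mem _ hf' (Subgroup.inv_mem _ hf)) ?_
    rw [← h1]
    exact Subgroup.mul_mem _ (Subgroup.inv_mem _ he') he
  rw [h2, map_one, inv_mul_eq_one] at h1
  exact ⟨h1.symm, (mul_inv_eq_one.1 h2).symm⟩

theorem card_eq_sq : Nat.card P = Nat.card (fixedSubgroup T) ^ 2 := by
  let F : fixedSubgroup T × fixedSubgroup T → P := fun x => x.1 * X x.2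
  have hF : Function.Bijective F := by
    constructor
    · rintro ⟨e, f⟩ ⟨e', f'⟩ hef
      obtain ⟨h1, h2⟩ := h.decomposition_unique e.2 f.2 e'.2 f'.2 hef
      exact Prod.ext (Subtype.ext h1) (Subtype.ext h2)
    · intro a
      obtain ⟨e, he, f, hf, rfl⟩ := h.exists_decomposition a
      exact ⟨(⟨e, he⟩, ⟨f, hf⟩), rfl⟩
  rw [← Nat.card_eq_of_bijective F hF, Nat.card_prod, sq]

/-- Moving e' past Xf costs [Xf, e'] = X²[f, e'] = [f, e'] · X[f, e']. Both components of the result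
are formed inside the fixed subgroup, so its group structure determines that of P. -/
theorem mul_X_mul_mul_X (e f e' f' : P) :
    (e * X f) * (e' * X f') = (e * comm f e' * e') * X (comm f e' * f * f') := by
  have hz := h.comm_mem f e'
  have h1 : X f * e' = comm f e' * X (comm f e') * (e' * X f) := by
    rw [← h.X_X_center hz, ← h.comm_X_left, ← comm_mul_swap]
  have h2 := mem_center_comm (map_mem_center X hz) e'
  calc (e * X f) * (e' * X f') = e * (X f * e') * X f' := by group
    _ = e * comm f e' * (X (comm f e') * e') * X f * X f' := by rw [h1]; group
    _ = _ := by rw [h2, map_mul, map_mul]; group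

/-- Commuting with f implies commuting with Xf, and the fixed subgroup together with its image under
X generates P. -/
theorem mem_center_of_commute_fixed {e : P}
    (he : ∀ f ∈ fixedSubgroup T, Commute e f) : e ∈ Subgroup.center P := by
  rw [Subgroup.mem_center_iff]
  intro a
  obtain ⟨f, hf, f', hf', rfl⟩ := h.exists_decomposition a
  exact ((he f hf).mul_right (h.commute_X_right (he f' hf'))).symm

/-- The extension is e · Xf ↦ α(e) · Xα(f). It is multiplicative by `mul_X_mul_mul_X`, since α
respects products and commutators. -/
theorem exists_extension (α : MulAut (fixedSubgroup T)) :
    ∃ φ : MulAut P, (∀ a, φ (X a) = X (φ a)) ∧ (∀ a, φ (T a) = T (φ a)) ∧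
      ∀ e : fixedSubgroup T, φ e = α e := by
  have hdec : ∀ a, ∃ e f : fixedSubgroup T, a = e * X f := fun a => by
    obtain ⟨e, he, f, hf, hef⟩ := h.exists_decomposition a
    exact ⟨⟨e, he⟩, ⟨f, hf⟩, hef⟩
  choose u v huv using hdec
  let F : P → P := fun a => α (u a) * X (α (v a))
  have hF : ∀ e f : fixedSubgroup T, F (e * X f) = α e * X (α f) := by
    intro e f
    obtain ⟨h1, h2⟩ := h.decomposition_unique e.2 f.2 (u (e * X f)).2 (v (e * X f)).2 (huv _)
    change α (u _) * X (α (v _)) = _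
    rw [← Subtype.ext h1, ← Subtype.ext h2]
  have hcoe : ∀ e f : fixedSubgroup T, comm (e : P) f = (comm e f : fixedSubgroup T) :=
    fun e f => by simp [comm]
  have hmul : ∀ a b, F (a * b) = F a * F b := by
    intro a b
    rw [huv a, huv b, h.mul_X_mul_mul_X, hF, hF, h.mul_X_mul_mul_X, hcoe, hcoe, ← map_comm]
    simp only [← Subgroup.coe_mul]
    rw [hF, map_mul, map_mul, map_mul, map_mul]
  have hF1 : ∀ e : fixedSubgroup T, F e = α e := fun e => by
    simpa using hF e 1
  have hFX : ∀ e : fixedSubgroup T, F (X e) = X (α e) := fun e => by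
    simpa using hF 1 e
  let Φ : P →* P := MonoidHom.mk' F hmul
  have hΦ1 : ∀ e : fixedSubgroup T, Φ e = α e := hF1
  have hΦX : ∀ e : fixedSubgroup T, Φ (X e) = X (α e) := hFX
  have hΦXX : ∀ e : fixedSubgroup T, Φ (X (X e)) = X (X (α e)) := fun e => by
    rw [h.X_X, map_mul, map_inv, map_inv, hΦ1, hΦX, ← h.X_X]
  refine ⟨MulEquiv.ofBijective Φ ⟨?_, ?_⟩, ?_, ?_, hΦ1⟩
  · rw [injective_iff_map_eq_one]
    intro a ha
    change (α (u a) : P) * X (α (v a)) = 1 at ha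
    obtain ⟨h1, h2⟩ := h.decomposition_unique (α (u a)).2 (α (v a)).2 (Subgroup.one_mem _)
      (Subgroup.one_mem _) (by rw [ha, map_one, one_mul])
    rw [OneMemClass.coe_eq_one, EmbeddingLike.map_eq_one_iff] at h1 h2
    rw [huv a, h1, h2]
    simp
  · intro a
    refine ⟨α.symm (u a) * X (α.symm (v a)), ?_⟩
    change F _ = _
    rw [hF, MulEquiv.apply_symm_apply, MulEquiv.apply_symm_apply, ← huv]
  · intro a
    change Φ (X a) = X (Φ a)
    rw [huv a, map_mul, map_mul, map_mul, map_mul, hΦX, hΦXX, hΦ1, hΦX]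
  · intro a
    have hT : ∀ e : fixedSubgroup T, T e = e := fun e => e.2
    change Φ (T a) = T (Φ a)
    rw [huv a, map_mul, map_mul, map_mul, map_mul, hΦ1, hΦX, h.T_X, h.T_X, hT, hT, hT, hT, hΦ1,
      hΦXX]

theorem eq_one_of_fixed (φ : MulAut P) (hX : ∀ a, φ (X a) = X (φ a))
    (hE : ∀ e ∈ fixedSubgroup T, φ e = e) : φ = 1 := by
  ext a
  obtain ⟨e, he, f, hf, rfl⟩ := h.exists_decomposition a
  rw [map_mul, hX, hE e he, hE f hf]
  rfl

/-! #### The subgroups generated by the centre, `e` and `X e` -/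

omit [Finite P] in
theorem zpow_cases (e : P) (i : ℤ) :
    ∃ c ∈ Subgroup.center P, e ^ i = c ∨ e ^ i = c * e := by
  have hc : ∀ k : ℤ, (e ^ 2) ^ k ∈ Subgroup.center P := fun k =>
    Subgroup.zpow_mem _ (h.sq_mem e) k
  obtain ⟨k, rfl | rfl⟩ := Int.even_or_odd' i
  · exact ⟨_, hc k, Or.inl (by rw [zpow_mul, zpow_ofNat])⟩
  · exact ⟨_, hc k, Or.inr (by rw [zpow_add, zpow_mul, zpow_one, zpow_ofNat])⟩

/-- The subgroup generated by the centre, `e` and `X e`. -/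
def natSubgroup (e : P) : Subgroup P where
  carrier := {g | ∃ c ∈ Subgroup.center P, ∃ i j : ℤ, g = c * (e ^ i * X e ^ j)}
  one_mem' := ⟨1, Subgroup.one_mem _, 0, 0, by simp⟩
  mul_mem' := by
    rintro _ _ ⟨c, hc, i, j, rfl⟩ ⟨c', hc', i', j', rfl⟩
    refine ⟨c * c', Subgroup.mul_mem _ hc hc', i + i', j + j', ?_⟩
    -- e commutes with itself, hence with Xe.
    have h1 := ((h.commute_X_right (Commute.refl e)).zpow_zpow i' j).eq
    have h2 := mem_center_comm hc' (e ^ i * X e ^ j)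
    calc c * (e ^ i * X e ^ j) * (c' * (e ^ i' * X e ^ j'))
        = c * ((e ^ i * X e ^ j) * c') * (e ^ i' * X e ^ j') := by simp only [mul_assoc]
      _ = c * c' * (e ^ i * (X e ^ j * e ^ i') * X e ^ j') := by
          rw [← h2]; simp only [mul_assoc]
      _ = _ := by rw [← h1, zpow_add, zpow_add]; simp only [mul_assoc]
  inv_mem' := by
    rintro _ ⟨c, hc, i, j, rfl⟩
    refine ⟨c⁻¹, Subgroup.inv_mem _ hc, -i, -j, ?_⟩
    have h1 := ((h.commute_X_right (Commute.refl e)).zpow_zpow (-i) (-j)).eq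
    rw [mul_inv_rev, mul_inv_rev, ← zpow_neg, ← zpow_neg, h1,
      mem_center_comm (Subgroup.inv_mem _ hc)]

theorem center_le_natSubgroup (e : P) : Subgroup.center P ≤ h.natSubgroup e :=
  fun c hc => ⟨c, hc, 0, 0, by simp⟩

theorem self_mem_natSubgroup (e : P) : e ∈ h.natSubgroup e :=
  ⟨1, Subgroup.one_mem _, 1, 0, by simp⟩

theorem X_self_mem_natSubgroup (e : P) : X e ∈ h.natSubgroup e :=
  ⟨1, Subgroup.one_mem _, 0, 1, by simp⟩

theorem natSubgroup_le {e : P} {N : Subgroup P} (hZ : Subgroup.center P ≤ N) (he : e ∈ N)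
    (hXe : X e ∈ N) : h.natSubgroup e ≤ N := by
  rintro _ ⟨c, hc, i, j, rfl⟩
  exact N.mul_mem (hZ hc) (N.mul_mem (N.zpow_mem he i) (N.zpow_mem hXe j))

theorem natSubgroup_cases {e g : P} (hg : g ∈ h.natSubgroup e) : ∃ c ∈ Subgroup.center P,
    g = c ∨ g = c * e ∨ g = c * X e ∨ g = c * X (X e) := by
  have hmul : ∀ {a b : P}, a ∈ Subgroup.center P → b ∈ Subgroup.center P →
      a * b ∈ Subgroup.center P := fun ha hb => Subgroup.mul_mem _ ha hb
  obtain ⟨c, hc, i, j, rfl⟩ := hg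
  obtain ⟨a, ha, h1 | h1⟩ := h.zpow_cases e i <;> obtain ⟨b, hb, h2 | h2⟩ := h.zpow_cases (X e) j
  · exact ⟨c * (a * b), hmul hc (hmul ha hb), Or.inl (by rw [h1, h2])⟩
  · exact ⟨c * (a * b), hmul hc (hmul ha hb), Or.inr (Or.inr (Or.inl (by
      rw [h1, h2]; simp only [mul_assoc])))⟩
  · refine ⟨c * (a * b), hmul hc (hmul ha hb), Or.inr (Or.inl ?_)⟩
    rw [h1, h2, mul_assoc a, ← mem_center_comm hb]
    simp only [mul_assoc]
  -- X²e is the inverse of e · Xe, so the two differ by the square of e · Xe, which is central.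
  · have hn : e * X e = (e ^ 2 * X e ^ 2) * X (X e) := by
      have hcm : Commute e (X e) := h.commute_X_right (Commute.refl e)
      rw [h.X_X, ← hcm.mul_pow, ← hcm.inv_inv.eq, ← mul_inv_rev, sq, hcm.eq]
      group
    refine ⟨c * (a * b) * (e ^ 2 * X e ^ 2), hmul (hmul hc (hmul ha hb))
      (hmul (h.sq_mem _) (h.sq_mem _)), Or.inr (Or.inr (Or.inr ?_))⟩
    calc c * (e ^ i * X e ^ j) = c * (a * (e * b) * X e) := by
          rw [h1, h2]; simp only [mul_assoc]
      _ = c * (a * b) * (e * X e) := by rw [← mem_center_comm hb]; simp only [mul_assoc]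
      _ = _ := by rw [hn]; simp only [mul_assoc]

theorem X_X_self_mem_natSubgroup (e : P) : X (X e) ∈ h.natSubgroup e := by
  rw [h.X_X]
  exact Subgroup.mul_mem _ (Subgroup.inv_mem _ (h.X_self_mem_natSubgroup e))
    (Subgroup.inv_mem _ (h.self_mem_natSubgroup e))

theorem natSubgroup_map_le {e : P} (φ : MulAut P) (he : φ e ∈ h.natSubgroup e)
    (hXe : φ (X e) ∈ h.natSubgroup e) {g : P} (hg : g ∈ h.natSubgroup e) :
    φ g ∈ h.natSubgroup e := by
  have : h.natSubgroup e ≤ (h.natSubgroup e).comap φ.toMonoidHom :=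
    h.natSubgroup_le (fun c hc => h.center_le_natSubgroup e (map_mem_center φ hc)) he hXe
  exact this hg

theorem X_mem_natSubgroup {e g : P} (hg : g ∈ h.natSubgroup e) : X g ∈ h.natSubgroup e :=
  h.natSubgroup_map_le X (h.X_self_mem_natSubgroup e) (h.X_X_self_mem_natSubgroup e) hg

theorem T_mem_natSubgroup {e g : P} (he : e ∈ fixedSubgroup T) (hg : g ∈ h.natSubgroup e) :
    T g ∈ h.natSubgroup e := by
  have he' : T e = e := he
  refine h.natSubgroup_map_le T ?_ ?_ hg
  · rw [he']
    exact h.self_mem_natSubgroup e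
  · rw [h.T_X, he']
    exact h.X_X_self_mem_natSubgroup e

theorem conj_mem_natSubgroup {e g : P} (a : P) (hg : g ∈ h.natSubgroup e) :
    a * g * a⁻¹ ∈ h.natSubgroup e := by
  have : a * g * a⁻¹ = comm a g * g := by
    unfold comm
    group
  rw [this]
  exact Subgroup.mul_mem _ (h.center_le_natSubgroup e (h.comm_mem a g)) hg

/-- X has no nontrivial fixed point on P/Z either: if Xa = ca with c central, the norm relation says
that a³ is central, and a² is central already. -/
theorem mem_center_of_X {a : P} (ha : X a * a⁻¹ ∈ Subgroup.center P) :
    a ∈ Subgroup.center P := by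
  have h1 := h.norm_eq_one a
  obtain ⟨c, hc⟩ : ∃ c, c = X a * a⁻¹ := ⟨_, rfl⟩
  rw [← hc] at ha
  have h2 : X a = c * a := by rw [hc]; group
  rw [h2, map_mul, h2] at h1
  have h3 : a = (a ^ 2)⁻¹ * (c * X c * c)⁻¹ * (a * (c * a) * (X c * (c * a))) := by
    have hXc := map_mem_center X ha
    have e1 : a * (c * a) * (X c * (c * a)) = (c * X c * c) * (a ^ 2 * a) := by
      have q1 := mem_center_comm ha a
      have q2 := mem_center_comm hXc a
      have q3 := mem_center_comm ha (a * a)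
      have q4 := mem_center_comm hXc (a * a)
      calc a * (c * a) * (X c * (c * a)) = (a * c) * a * (X c * c) * a := by
            simp only [mul_assoc]
        _ = c * ((a * a) * X c * c * a) := by rw [← q1]; simp only [mul_assoc]
        _ = c * (X c * ((a * a) * c * a)) := by rw [← q4]; simp only [mul_assoc]
        _ = _ := by rw [← q3]; simp only [mul_assoc, sq]
    rw [e1]
    group
  rw [h3, h1, mul_one]
  exact Subgroup.mul_mem _ (Subgroup.inv_mem _ (h.sq_mem a)) (Subgroup.inv_mem _
    (Subgroup.mul_mem _ (Subgroup.mul_mem _ ha (map_mem_center X ha)) ha))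

/-- Modulo the centre T fixes e and interchanges Xe and X²e. These two cosets coincide only when e
is central. -/
theorem natSubgroup_fixed {e g : P} (he : e ∈ fixedSubgroup T) (hg : g ∈ h.natSubgroup e)
    (hT : T g * g⁻¹ ∈ Subgroup.center P) :
    g ∈ Subgroup.center P ∨ g * e⁻¹ ∈ Subgroup.center P := by
  have he' : T e = e := he
  obtain ⟨c, hc, hg⟩ := h.natSubgroup_cases hg
  have hcases : ∀ a b : P, c * a = g → T c * b * (c * a)⁻¹ ∈ Subgroup.center P →
      b * a⁻¹ ∈ Subgroup.center P := by
    intro a b _ hab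
    have h1 : b * a⁻¹ = (T c)⁻¹ * (T c * b * (c * a)⁻¹) * c := by group
    rw [h1]
    exact Subgroup.mul_mem _ (Subgroup.mul_mem _ (Subgroup.inv_mem _ (map_mem_center T hc)) hab) hc
  rcases hg with rfl | rfl | rfl | rfl
  · exact Or.inl hc
  · right
    rwa [mul_inv_cancel_right]
  · left
    rw [map_mul, h.T_X, he'] at hT
    have := h.mem_center_of_X (hcases _ _ rfl hT)
    exact Subgroup.mul_mem _ hc this
  · left
    rw [map_mul, h.T_X, h.T_X, he', h.X_cube] at hT
    have h1 := Subgroup.inv_mem _ (hcases _ _ rfl hT)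
    rw [mul_inv_rev, inv_inv] at h1
    exact Subgroup.mul_mem _ hc (map_mem_center X (h.mem_center_of_X h1))

/-- X permutes the cosets of e, Xe and X²e cyclically, so an X-invariant subgroup containing the
centre and one of them contains all. This gives the irreducibility of dents. -/
theorem natSubgroup_le_of_mem {e n : P} {N : Subgroup P} (hZ : Subgroup.center P ≤ N)
    (hX : ∀ a ∈ N, X a ∈ N) (hn : n ∈ N) (hne : n ∈ h.natSubgroup e)
    (hnZ : n ∉ Subgroup.center P) : h.natSubgroup e ≤ N := by
  obtain ⟨c, hc, hcases⟩ := h.natSubgroup_cases hne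
  have hmem : ∀ a, n = c * a → a ∈ N := by
    rintro a rfl
    simpa using N.mul_mem (N.inv_mem (hZ hc)) hn
  have he : e ∈ N := by
    rcases hcases with h1 | h1 | h1 | h1
    · exact absurd (h1 ▸ hc) hnZ
    · exact hmem _ h1
    · have := hX _ (hX _ (hmem _ h1))
      rwa [h.X_cube] at this
    · have := hX _ (hmem _ h1)
      rwa [h.X_cube] at this
  exact h.natSubgroup_le hZ he (hX _ he)

theorem natSubgroup_congr_le {e f : P} (hef : e⁻¹ * f ∈ Subgroup.center P) :
    h.natSubgroup f ≤ h.natSubgroup e := by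
  have hf : f = e * (e⁻¹ * f) := by group
  have hfm : f ∈ h.natSubgroup e := by
    rw [hf]
    exact Subgroup.mul_mem _ (h.self_mem_natSubgroup e) (h.center_le_natSubgroup e hef)
  exact h.natSubgroup_le (h.center_le_natSubgroup e) hfm (h.X_mem_natSubgroup hfm)

theorem natSubgroup_eq_iff {e f : P} (he : e ∈ fixedSubgroup T) (hf : f ∈ fixedSubgroup T) :
    h.natSubgroup e = h.natSubgroup f ↔ e⁻¹ * f ∈ Subgroup.center P := by
  have hinv : ∀ a b : P, a⁻¹ * b ∈ Subgroup.center P → b⁻¹ * a ∈ Subgroup.center P := by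
    intro a b hab
    have := Subgroup.inv_mem _ hab
    rwa [mul_inv_rev, inv_inv] at this
  constructor
  · intro hef
    have key : ∀ {e f : P}, e ∈ fixedSubgroup T → f ∈ fixedSubgroup T →
        h.natSubgroup e = h.natSubgroup f →
        f ∈ Subgroup.center P ∨ f * e⁻¹ ∈ Subgroup.center P := by
      intro e f he hf hef
      have hf' : T f = f := hf
      exact h.natSubgroup_fixed he (hef ▸ h.self_mem_natSubgroup f)
        (by rw [hf', mul_inv_cancel]; exact Subgroup.one_mem _)
    have hconj : ∀ {e f : P}, f * e⁻¹ ∈ Subgroup.center P → e⁻¹ * f ∈ Subgroup.center P := by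
      intro e f hfe
      have : e⁻¹ * f = f * e⁻¹ := by
        have := mem_center_comm hfe e
        rw [inv_mul_eq_iff_eq_mul, ← this]
        group
      rwa [this]
    rcases key he hf hef with h1 | h1
    · rcases key hf he hef.symm with h2 | h2
      · exact Subgroup.mul_mem _ (Subgroup.inv_mem _ h2) h1
      · exact hinv _ _ (hconj h2)
    · exact hconj h1
  · intro hef
    exact le_antisymm (h.natSubgroup_congr_le (hinv _ _ hef)) (h.natSubgroup_congr_le hef)

theorem natSubgroup_commute {e f a b : P} (hef : Commute e f) (ha : a ∈ h.natSubgroup e)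
    (hb : b ∈ h.natSubgroup f) : Commute a b := by
  obtain ⟨c, hc, i, j, rfl⟩ := ha
  obtain ⟨c', hc', i', j', rfl⟩ := hb
  have h1 := h.commute_X_right hef
  have h2 := h.commute_X_left hef
  have h3 := h.commute_X_left h1
  refine Commute.mul_left (mem_center_comm hc _) (Commute.mul_right (mem_center_comm hc' _).symm ?_)
  exact ((hef.zpow_zpow _ _).mul_right (h1.zpow_zpow _ _)).mul_left
    ((h2.zpow_zpow _ _).mul_right (h3.zpow_zpow _ _))

theorem natSubgroup_sq {e a : P} (he : e ^ 2 = 1) (ha : a ∈ h.natSubgroup e) : a ^ 2 = 1 := by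
  have hX : (X e) ^ 2 = 1 := by rw [← map_pow, he, map_one]
  have hXX : (X (X e)) ^ 2 = 1 := by rw [← map_pow, hX, map_one]
  obtain ⟨c, hc, hcases⟩ := h.natSubgroup_cases ha
  have hmul : ∀ b : P, b ^ 2 = 1 → (c * b) ^ 2 = 1 := fun b hb => by
    have hcb : Commute c b := mem_center_comm hc b
    rw [hcb.mul_pow, h.center_sq c hc, hb, one_mul]
  rcases hcases with rfl | rfl | rfl | rfl
  · exact h.center_sq _ hc
  · exact hmul _ he
  · exact hmul _ hX
  · exact hmul _ hXX

/-- A coset of the centre fixed by T contains an element fixed by T, so fixed points can be lifted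
from a dent modulo Z to Q. -/
theorem exists_fixed_mul {d : P} (hd : T d * d⁻¹ ∈ Subgroup.center P) :
    ∃ c ∈ Subgroup.center P, d * c ∈ fixedSubgroup T := by
  obtain ⟨y, hy⟩ : ∃ y, y = T d * d⁻¹ := ⟨_, rfl⟩
  rw [← hy] at hd
  have h1 : T d = d * y := by
    rw [← mem_center_comm hd, hy]
    group
  have h2 : T y = y := by
    have h3 : T (T d) = T (d * y) := by rw [h1]
    rw [h.T_sq, map_mul, h1, mul_assoc, left_eq_mul] at h3
    rw [← inv_eq_of_mul_eq_one_right h3, h.center_inv hd]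
  -- T(Xy) = X²y = y · Xy, and the extra factor y cancels the one in Td = dy.
  refine ⟨X y, map_mem_center X hd, ?_⟩
  rw [mem_fixedSubgroup, map_mul, h.T_X, h1, h2, h.X_X_center hd, mul_assoc, ← mul_assoc y,
    ← sq, h.center_sq y hd, one_mul]

end IsFixedPointFreeAction

/-! ### Generators of a complement -/

/-- `π : G → L₂(2)` is the projection of a biextraspecial group with complement `L`, and `x` and
`t` are elements of `L` of order three and two. -/
structure IsFrame {G : Type*} [Group G] (Q L : Subgroup G) (m : ℕ)
    (π : G →* GL (Fin 2) (ZMod 2)) (x t : G) : Prop where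
  biextraspecial : IsBiextraspecial Q m
  isComplement : Q.IsComplement' L
  ker_eq : π.ker = Q
  natural_centre : IsNaturalSection π ⊥ (centre Q)
  natural_factor : ∀ A B : Subgroup G, A.Normal → B.Normal → centre Q ≤ A → A < B → B ≤ Q →
      (∀ N : Subgroup G, N.Normal → A ≤ N → N ≤ B → N = A ∨ N = B) →
      IsNaturalSection π A B
  x_mem : x ∈ L
  t_mem : t ∈ L
  map_x : (π x : Matrix (Fin 2) (Fin 2) (ZMod 2)) = !![0, 1; 1, 1]
  map_t : (π t : Matrix (Fin 2) (Fin 2) (ZMod 2)) = !![0, 1; 1, 0]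

theorem gl_two_cases (h : GL (Fin 2) (ZMod 2)) : ∃ i < 3, ∃ j < 2,
    (h : Matrix (Fin 2) (Fin 2) (ZMod 2)) = !![0, 1; 1, 1] ^ i * !![0, 1; 1, 0] ^ j := by
  have key : ∀ a b c d : ZMod 2, a * d - b * c ≠ 0 → ∃ i < 3, ∃ j < 2,
      !![a, b; c, d] = !![0, 1; 1, 1] ^ i * !![0, 1; 1, 0] ^ j := by decide
  have h1 := key (h.1 0 0) (h.1 0 1) (h.1 1 0) (h.1 1 1) (by
    rw [← Matrix.det_fin_two]
    exact ((Matrix.isUnit_iff_isUnit_det _).1 h.isUnit).ne_zero)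
  rwa [← Matrix.eta_fin_two] at h1

theorem exists_isFrame {G : Type*} [Group G] {Q L : Subgroup G} {m : ℕ}
    (hG : IsBiextraspecial Q m) (hL : Q.IsComplement' L) :
    ∃ π x t, IsFrame Q L m π x t := by
  obtain ⟨π, hsurj, hker, hnat, hfac⟩ := hG.exists_module
  have hsurjL : ∀ h, ∃ l ∈ L, π l = h := by
    intro h
    obtain ⟨g, rfl⟩ := hsurj h
    obtain ⟨⟨q, l⟩, hql⟩ := hL.surjective g
    refine ⟨l, l.2, ?_⟩
    have : π q = 1 := by
      rw [← MonoidHom.mem_ker, hker]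
      exact q.2
    rw [← hql]
    simp [this]
  obtain ⟨x, hx, hxm⟩ := hsurjL (⟨!![0, 1; 1, 1], !![1, 1; 1, 0], by decide, by decide⟩)
  obtain ⟨t, ht, htm⟩ := hsurjL (⟨!![0, 1; 1, 0], !![0, 1; 1, 0], by decide, by decide⟩)
  exact ⟨π, x, t, hG, hL, hker, hnat, hfac, hx, ht, by rw [hxm], by rw [htm]⟩

theorem mem_centre_coe {G : Type*} [Group G] {Q : Subgroup G} {z : Q} :
    (z : G) ∈ centre Q ↔ z ∈ Subgroup.center Q := by
  unfold centre
  simp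

theorem centre_le {G : Type*} [Group G] (Q : Subgroup G) : centre Q ≤ Q :=
  Subgroup.map_subtype_le _

/-! ### The structure of G relative to `x` and `t` -/

namespace IsFrame

variable {G : Type*} [Group G] {Q L : Subgroup G} [Q.Normal] {m : ℕ}
  {π : G →* GL (Fin 2) (ZMod 2)} {x t : G} (h : IsFrame Q L m π x t)
include h

omit [Q.Normal] in
theorem map_eq_one {g : G} : π g = 1 ↔ g ∈ Q := by
  rw [← MonoidHom.mem_ker, h.ker_eq]

omit [Q.Normal] in
theorem eq_of_map_eq {g k : G} (hg : g ∈ L) (hk : k ∈ L) (hgk : π g = π k) : g = k := by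
  have h1 : g * k⁻¹ ∈ Q := by rw [← h.map_eq_one, map_mul, map_inv, hgk, mul_inv_cancel]
  exact mul_inv_eq_one.1 (Subgroup.disjoint_def.1 h.isComplement.disjoint h1
    (L.mul_mem hg (L.inv_mem hk)))

omit [Q.Normal] in
theorem x_cube : x ^ 3 = 1 := by
  refine h.eq_of_map_eq (L.pow_mem h.x_mem 3) L.one_mem ?_
  ext1
  rw [map_pow, Units.val_pow_eq_pow_val, h.map_x, map_one]
  decide

omit [Q.Normal] in
theorem t_sq : t ^ 2 = 1 := by
  refine h.eq_of_map_eq (L.pow_mem h.t_mem 2) L.one_mem ?_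
  ext1
  rw [map_pow, Units.val_pow_eq_pow_val, h.map_t, map_one]
  decide

omit [Q.Normal] in
theorem t_x : t * x = x ^ 2 * t := by
  refine h.eq_of_map_eq (L.mul_mem h.t_mem h.x_mem)
    (L.mul_mem (L.pow_mem h.x_mem 2) h.t_mem) ?_
  ext1
  rw [map_mul, map_mul, map_pow, Units.val_mul, Units.val_mul, Units.val_pow_eq_pow_val, h.map_x,
    h.map_t]
  decide

omit [Q.Normal] in
theorem t_inv : t⁻¹ = t := by
  rw [inv_eq_iff_mul_eq_one, ← sq, h.t_sq]

omit [Q.Normal] in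
theorem t_inv_conj_x : t⁻¹ * x * t = x ^ 2 := by
  rw [h.t_inv, h.t_x, mul_assoc, ← sq, h.t_sq, mul_one]

omit [Q.Normal] in
theorem exists_map_eq (g : G) : ∃ i < 3, ∃ j < 2, π g = π (x ^ i * t ^ j) := by
  obtain ⟨i, hi, j, hj, hij⟩ := gl_two_cases (π g)
  refine ⟨i, hi, j, hj, ?_⟩
  ext1
  rw [hij, map_mul, map_pow, map_pow, Units.val_mul, Units.val_pow_eq_pow_val,
    Units.val_pow_eq_pow_val, h.map_x, h.map_t]

omit [Q.Normal] in
theorem exists_eq_of_mem {l : G} (hl : l ∈ L) : ∃ i < 3, ∃ j < 2, l = x ^ i * t ^ j := by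
  obtain ⟨i, hi, j, hj, hij⟩ := h.exists_map_eq l
  exact ⟨i, hi, j, hj, h.eq_of_map_eq hl
    (L.mul_mem (L.pow_mem h.x_mem i) (L.pow_mem h.t_mem j)) hij⟩

omit [Q.Normal] in
theorem mem_of_generators (M : Submonoid G) (hQ : ∀ a ∈ Q, a ∈ M) (hx : x ∈ M) (ht : t ∈ M)
    (g : G) : g ∈ M := by
  obtain ⟨i, -, j, -, hij⟩ := h.exists_map_eq g
  have h1 : g * (x ^ i * t ^ j)⁻¹ ∈ Q := by
    rw [← h.map_eq_one, map_mul, map_inv, hij, mul_inv_cancel]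
  have h2 : g = g * (x ^ i * t ^ j)⁻¹ * (x ^ i * t ^ j) := by group
  rw [h2]
  exact M.mul_mem (hQ _ h1) (M.mul_mem (M.pow_mem hx i) (M.pow_mem ht j))

omit [Q.Normal] in
theorem finite_Q : Finite Q :=
  Nat.finite_of_card_ne_zero (by rw [h.biextraspecial.card_eq]; positivity)

omit [Q.Normal] in
theorem finite_L : Finite L := by
  refine Finite.of_injective (fun l : L => π l) fun l l' hll => ?_
  exact Subtype.ext (h.eq_of_map_eq l.2 l'.2 hll)

omit [Q.Normal] in
theorem finite : Finite G := by
  have := h.finite_Q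
  have := h.finite_L
  exact Finite.of_surjective _ h.isComplement.surjective

omit [Q.Normal] in
theorem card_L : Nat.card L = 6 := by
  have hb : Function.Bijective (fun l : L => π l) := by
    refine ⟨fun l l' hll => Subtype.ext (h.eq_of_map_eq l.2 l'.2 hll), fun g => ?_⟩
    obtain ⟨i, hi, j, hj, hij⟩ := gl_two_cases g
    refine ⟨⟨x ^ i * t ^ j, L.mul_mem (L.pow_mem h.x_mem i) (L.pow_mem h.t_mem j)⟩, ?_⟩
    ext1
    rw [hij]
    simp [h.map_x, h.map_t]
  rw [Nat.card_eq_of_bijective _ hb, Matrix.card_GL_field]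
  simp [Fin.prod_univ_succ]

omit [Q.Normal] in
/-- Conjugation by `x` has no fixed points on a natural section. -/
theorem mem_of_natural {A B : Subgroup G} (hn : IsNaturalSection π A B) (hB : B.Normal)
    {b : G} (hb : b ∈ B) (hx : x * b * x⁻¹ * b⁻¹ ∈ A) : b ∈ A := by
  obtain ⟨f, -, hker, heq⟩ := hn
  have hmem : ∀ c : B, f c = 1 ↔ (c : G) ∈ A := fun c => by
    rw [← MonoidHom.mem_ker, hker, Subgroup.mem_subgroupOf]
  let b' : B := ⟨x * b * x⁻¹, hB.conj_mem b hb x⟩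
  have h1 : f b' = f ⟨b, hb⟩ := by
    rw [← mul_inv_eq_one, ← map_inv, ← map_mul, hmem]
    exact hx
  have h2 := heq x ⟨b, hb⟩ b' rfl
  rw [h1, h.map_x] at h2
  have key : ∀ v : Fin 2 → ZMod 2, v = Matrix.mulVec !![0, 1; 1, 1] v → v = 0 := by decide
  have h3 := key _ h2
  have h4 : f ⟨b, hb⟩ = 1 := Multiplicative.toAdd.injective h3
  exact (hmem _).1 h4

/-- Q acts trivially on Q/Z and ⟨x⟩Q is normal in G, so the fixed points of `x` on Q/Z form a
G-invariant subgroup N/Z. If it were nontrivial, a minimal normal B with Z < B ≤ N would give a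
natural module B/Z on which `x` acts trivially, which is impossible. -/
theorem mem_centre_of_commutator {a : G} (ha : a ∈ Q) (hxa : x * a * x⁻¹ * a⁻¹ ∈ centre Q) :
    a ∈ centre Q := by
  have := h.finite
  let mk := QuotientGroup.mk' (centre Q)
  have hmk : ∀ a b : G, Commute (mk a) (mk b) ↔ a * b * a⁻¹ * b⁻¹ ∈ centre Q := by
    intro a b
    rw [← QuotientGroup.eq_one_iff, Commute, SemiconjBy, ← mul_inv_eq_iff_eq_mul, ← mul_inv_eq_one]
    rfl
  let N : Subgroup G := Q ⊓ (Subgroup.centralizer {mk x}).comap mk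
  have hN : ∀ n, n ∈ N ↔ n ∈ Q ∧ Commute (mk x) (mk n) := by
    intro n
    rw [Subgroup.mem_inf, Subgroup.mem_comap, Subgroup.mem_centralizer_singleton_iff]
    exact and_congr_right fun _ => eq_comm
  have hNn : N.Normal := by
    refine ⟨fun n hn g => ?_⟩
    rw [hN] at hn ⊢
    refine ⟨‹Q.Normal›.conj_mem n hn.1 g, ?_⟩
    have h1 : Commute (mk (g⁻¹ * x * g)) (mk n) := by
      -- Conjugates of `x` are congruent modulo Q to `x` or x².
      have h2 : ∃ i : ℕ, g⁻¹ * x * g * (x ^ i)⁻¹ ∈ Q := by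
        obtain ⟨i, hi, j, hj, hij⟩ := h.exists_map_eq g
        have hj' : j = 0 ∨ j = 1 := by omega
        have h3 : ∀ k, (x ^ i * t ^ j)⁻¹ * x * (x ^ i * t ^ j) = x ^ k →
            g⁻¹ * x * g * (x ^ k)⁻¹ ∈ Q := by
          intro k hk
          have : π (g⁻¹ * x * g * (x ^ k)⁻¹) =
              π ((x ^ i * t ^ j)⁻¹ * x * (x ^ i * t ^ j) * (x ^ k)⁻¹) := by
            simp only [map_mul π _ x, map_mul π _ g, map_mul π _ (x ^ i * t ^ j),
              map_mul π _ (x ^ k)⁻¹, map_inv, hij]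
          rw [← h.map_eq_one, this, hk, mul_inv_cancel, map_one]
        rcases hj' with rfl | rfl
        · exact ⟨1, h3 1 (by group)⟩
        · refine ⟨2, h3 2 ?_⟩
          rw [← h.t_inv_conj_x]
          group
      obtain ⟨i, hi⟩ := h2
      have h3 : g⁻¹ * x * g = g⁻¹ * x * g * (x ^ i)⁻¹ * x ^ i := by group
      rw [h3, map_mul, map_pow]
      exact ((hmk _ _).2 (h.biextraspecial.commutator_mem _ hi _ hn.1)).mul_left
        (hn.2.pow_left i)
    have h2 : Commute (mk g * mk (g⁻¹ * x * g) * (mk g)⁻¹) (mk g * mk n * (mk g)⁻¹) :=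
      (Commute.conj_iff (mk g)).2 h1
    convert h2 using 1
    · rw [← map_inv, ← map_mul, ← map_mul]
      congr 1
      group
    · simp
  have hZN : centre Q ≤ N := by
    intro z hz
    rw [hN]
    refine ⟨centre_le Q hz, ?_⟩
    have : mk z = 1 := (QuotientGroup.eq_one_iff z).2 hz
    rw [this]
    exact Commute.one_right _
  have haN : a ∈ N := (hN a).2 ⟨ha, (hmk _ _).2 hxa⟩
  by_contra haZ
  have hne : (N.Normal ∧ centre Q < N ∧ N ≤ N) :=
    ⟨hNn, lt_of_le_of_ne hZN (fun heq => haZ (heq ▸ haN)), le_rfl⟩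
  obtain ⟨B, hBmin⟩ := (Set.toFinite {B : Subgroup G | B.Normal ∧ centre Q < B ∧ B ≤ N}).exists_minimal
    ⟨N, hne⟩
  obtain ⟨⟨hBn, hZB, hBN⟩, hmin⟩ := hBmin
  have hBQ : B ≤ Q := hBN.trans inf_le_left
  have hnat := h.natural_factor (centre Q) B inferInstance hBn le_rfl hZB hBQ (by
    intro N' hN' hZN' hN'B
    rcases hZN'.eq_or_lt with h1 | h1
    · exact Or.inl h1.symm
    · exact Or.inr (le_antisymm hN'B (hmin ⟨hN', h1, hN'B.trans hBN⟩ hN'B)))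
  obtain ⟨b, hb, hbZ⟩ := SetLike.exists_of_lt hZB
  exact hbZ (h.mem_of_natural hnat hBn hb ((hmk _ _).1 ((hN b).1 (hBN hb)).2))

end IsFrame

/-- Restriction of automorphisms to an invariant subgroup. -/
def restrictHom {A H : Type*} [Group A] [Group H] (r : A →* MulAut H) (S : Subgroup H)
    (hS : ∀ a, ∀ s ∈ S, r a s ∈ S) : A →* MulAut S where
  toFun a :=
    { toFun := fun s => ⟨r a s, hS a s s.2⟩
      invFun := fun s => ⟨r a⁻¹ s, hS a⁻¹ s s.2⟩
      left_inv := fun s => Subtype.ext (by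
        change r a⁻¹ (r a s) = s
        rw [← MulAut.mul_apply, ← map_mul, inv_mul_cancel, map_one, MulAut.one_apply])
      right_inv := fun s => Subtype.ext (by
        change r a (r a⁻¹ s) = s
        rw [← MulAut.mul_apply, ← map_mul, mul_inv_cancel, map_one, MulAut.one_apply])
      map_mul' := fun s s' => Subtype.ext (map_mul (r a) (s : H) s') }
  map_one' := by
    ext s
    change r 1 s = s
    rw [map_one, MulAut.one_apply]
  map_mul' a b := by
    ext s
    change r (a * b) s = r a (r b s)
    rw [map_mul, MulAut.mul_apply]

namespace IsFrame

variable {G : Type*} [Group G] {Q L : Subgroup G} [Q.Normal] {m : ℕ}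
  {π : G →* GL (Fin 2) (ZMod 2)} {x t : G} (h : IsFrame Q L m π x t)
include h

theorem eq_one_of_commute_x {a : G} (ha : a ∈ Q) (hxa : x * a * x⁻¹ = a) : a = 1 := by
  have h1 := h.mem_centre_of_commutator ha (by
    rw [hxa, mul_inv_cancel]; exact Subgroup.one_mem _)
  have h2 := h.mem_of_natural h.natural_centre inferInstance h1 (by
    rw [hxa, mul_inv_cancel]; exact Subgroup.one_mem _)
  exact Subgroup.mem_bot.1 h2

theorem isFixedPointFreeAction :
    IsFixedPointFreeAction (MulAut.conjNormal x : MulAut Q) (MulAut.conjNormal t) := by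
  have hX3 : (MulAut.conjNormal x : MulAut Q) ^ 3 = 1 := by rw [← map_pow, h.x_cube, map_one]
  have hT2 : (MulAut.conjNormal t : MulAut Q) ^ 2 = 1 := by rw [← map_pow, h.t_sq, map_one]
  have hTX : (MulAut.conjNormal t : MulAut Q) * MulAut.conjNormal x =
      MulAut.conjNormal x ^ 2 * MulAut.conjNormal t := by
    rw [← map_mul, h.t_x, map_mul, map_pow]
  obtain ⟨f, hsurj, hker, heq⟩ := h.natural_centre
  have hinj : Function.Injective f := by
    rw [← MonoidHom.ker_eq_bot_iff, hker]
    simp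
  have hmem : ∀ c : Q, c ∈ Subgroup.center Q → (c : G) ∈ centre Q := fun c => mem_centre_coe.2
  have hsq : ∀ v : Multiplicative (Fin 2 → ZMod 2), v ^ 2 = 1 := by decide
  refine ⟨fun a => ?_, fun a => ?_, fun a => ?_, fun a ha => ?_, fun a b => ?_, fun a => ?_,
    fun c hc => ?_, ?_⟩
  · exact DFunLike.congr_fun hX3 a
  · exact DFunLike.congr_fun hT2 a
  · exact DFunLike.congr_fun hTX a
  · exact Subtype.ext (h.eq_one_of_commute_x a.2 (congrArg Subtype.val ha))
  · exact mem_centre_coe.1 (h.biextraspecial.commutator_mem a a.2 b b.2)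
  · exact mem_centre_coe.1 (h.biextraspecial.sq_mem a a.2)
  · have h1 : (⟨c, hmem c hc⟩ : centre Q) ^ 2 = 1 := hinj (by rw [map_pow, hsq, map_one])
    exact Subtype.ext (congrArg (Subtype.val : centre Q → G) h1 :)
  · obtain ⟨b, hb⟩ := hsurj (Multiplicative.ofAdd ![1, 1])
    have hT : ∀ c : centre Q, t * (c : G) * t⁻¹ = c ↔ f c = 1 ∨ f c = f b := by
      intro c
      have h1 := heq t c ⟨_, (centre_normal Q).conj_mem c c.2 t⟩ rfl
      rw [h.map_t] at h1
      -- The swap fixes exactly one nonzero vector, (1, 1); its preimage is the involution of Z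
      -- fixed by `t`.
      have key : ∀ v : Fin 2 → ZMod 2, Matrix.mulVec !![0, 1; 1, 0] v = v ↔
        v = 0 ∨ v = ![1, 1] := by decide
      have h2 : t * (c : G) * t⁻¹ = c ↔
          f ⟨_, (centre_normal Q).conj_mem c c.2 t⟩ = f c := by
        rw [hinj.eq_iff, Subtype.ext_iff]
      rw [h2, ← Multiplicative.toAdd.injective.eq_iff, h1, key, hb]
      rfl
    refine ⟨⟨b, centre_le Q b.2⟩, mem_centre_coe.1 b.2, ?_, ?_, ?_⟩
    · intro hb1
      have : b = 1 := Subtype.ext (congrArg (Subtype.val : Q → G) hb1 :)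
      rw [this, map_one] at hb
      revert hb
      decide
    · exact Subtype.ext ((hT b).2 (Or.inr rfl))
    · intro c hc hTc
      rcases (hT ⟨c, hmem c hc⟩).1 (congrArg Subtype.val hTc) with h1 | h1
      · left
        have := hinj (h1.trans (map_one f).symm)
        exact Subtype.ext (congrArg (Subtype.val : centre Q → G) this :)
      · right
        have := hinj h1
        exact Subtype.ext (congrArg (Subtype.val : centre Q → G) this :)

/-! ### Automorphisms -/

omit [Q.Normal] in
theorem exists_pow_eq_one {a : G} (ha : a ∈ Q) : a ^ 2 ^ (2 + 2 * m) = 1 := by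
  have := pow_card_eq_one' (x := (⟨a, ha⟩ : Q))
  rw [h.biextraspecial.card_eq] at this
  exact congrArg Subtype.val this

omit [Q.Normal] in
theorem map_sq_eq_one (α : MulAut G) {a : G} (ha : a ∈ Q) : π (α a) ^ 2 = 1 := by
  have h1 : π (α a) ^ 2 ^ (2 + 2 * m) = 1 := by
    rw [← map_pow, ← map_pow, h.exists_pow_eq_one ha, map_one, map_one]
  have h2 : π (α a) ^ (2 * 3) = 1 := by
    obtain ⟨i, hi, j, hj, hij⟩ := gl_two_cases (π (α a))
    ext1
    rw [Units.val_pow_eq_pow_val, hij, Units.val_one]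
    clear hij
    revert i j
    decide
  rw [← orderOf_dvd_iff_pow_eq_one] at *
  refine Nat.Coprime.dvd_of_dvd_mul_right ?_ h2
  exact Nat.Coprime.coprime_dvd_left h1 (Nat.Coprime.pow_left _ (by decide))

/-- Q is characteristic. If α(a) mapped to an involution s of L₂(2), then an element of Q, the
product of a conjugate of a with a, would map to xsx⁻¹s of order three, against `map_sq_eq_one`. -/
theorem map_mem (α : MulAut G) {a : G} (ha : a ∈ Q) : α a ∈ Q := by
  rw [← h.map_eq_one]
  have h1 := h.map_sq_eq_one α ha
  have h2 := h.map_sq_eq_one α (Q.mul_mem (‹Q.Normal›.conj_mem a ha (α⁻¹ x)) ha)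
  have h3 : α (α⁻¹ x * a * (α⁻¹ x)⁻¹ * a) = x * α a * x⁻¹ * α a := by
    simp only [map_mul, map_inv, MulAut.apply_inv_self]
  rw [h3, map_mul, map_mul, map_mul, map_inv] at h2
  have hx : (π x)⁻¹ = π x ^ 2 := by
    rw [inv_eq_iff_mul_eq_one, ← pow_succ', ← map_pow, h.x_cube, map_one]
  rw [hx] at h2
  obtain ⟨i, hi, j, hj, hij⟩ := gl_two_cases (π (α a))
  have h1 := congrArg Units.val h1
  have h2 := congrArg Units.val h2
  simp only [Units.val_pow_eq_pow_val, Units.val_mul, hij, h.map_x, Units.val_one] at h1 h2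
  ext1
  rw [hij, Units.val_one]
  clear hij
  interval_cases i <;> interval_cases j <;> revert h1 h2 <;> decide

omit [Q.Normal] in
theorem mem_autCentralizer {α : MulAut G} :
    α ∈ autCentralizer L ↔ α x = x ∧ α t = t := by
  refine ⟨fun hα => ⟨hα x h.x_mem, hα t h.t_mem⟩, fun ⟨hx, ht⟩ l hl => ?_⟩
  obtain ⟨i, -, j, -, rfl⟩ := h.exists_eq_of_mem hl
  rw [map_mul, map_pow, map_pow, hx, ht]

omit [Q.Normal] in
theorem exists_decomposition (g : G) : ∃ (q : Q) (l : L), g = q * l := by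
  obtain ⟨⟨q, l⟩, hql⟩ := h.isComplement.surjective g
  exact ⟨q, l, hql.symm⟩

omit [Q.Normal] in
theorem decomposition_unique {q q' : Q} {l l' : L} (heq : (q * l : G) = q' * l') :
    q = q' ∧ l = l' := by
  have h1 : (q, l) = (q', l') := h.isComplement.injective heq
  exact Prod.ext_iff.1 h1

omit [Q.Normal] in
theorem eq_of_eqOn {α β : MulAut G} (hα : α ∈ autCentralizer L) (hβ : β ∈ autCentralizer L)
    (hQ : ∀ a ∈ Q, α a = β a) : α = β := by
  ext g
  obtain ⟨q, l, rfl⟩ := h.exists_decomposition g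
  rw [map_mul, map_mul, hα l l.2, hβ l l.2, hQ q q.2]

/-- Restriction to `Q` of the automorphisms centralising `L`. -/
def restrictQ : autCentralizer L →* MulAut Q :=
  restrictHom (autCentralizer L).subtype Q fun α _ ha => h.map_mem α.1 ha

theorem restrictQ_apply (α : autCentralizer L) (a : Q) : (h.restrictQ α a : G) = α.1 a := rfl

theorem restrictQ_conjNormal (α : autCentralizer L) {l : G} (hl : l ∈ L) (a : Q) :
    h.restrictQ α (MulAut.conjNormal l a) = MulAut.conjNormal l (h.restrictQ α a) := by
  apply Subtype.ext
  rw [restrictQ_apply, MulAut.conjNormal_apply, MulAut.conjNormal_apply, restrictQ_apply, map_mul,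
    map_mul, map_inv, α.2 l hl]

/-- G is the semidirect product of Q and L, so an automorphism of Q commuting with the action of L
extends by the identity on L. -/
theorem exists_extension (φ : MulAut Q)
    (hx : ∀ a, φ (MulAut.conjNormal x a) = MulAut.conjNormal x (φ a))
    (ht : ∀ a, φ (MulAut.conjNormal t a) = MulAut.conjNormal t (φ a)) :
    ∃ α : autCentralizer L, h.restrictQ α = φ := by
  have hl : ∀ (l : L) (a : Q), φ (MulAut.conjNormal (l : G) a) =
      MulAut.conjNormal (l : G) (φ a) := by
    intro l a
    obtain ⟨i, -, j, -, hij⟩ := h.exists_eq_of_mem l.2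
    have hcx : Commute φ (MulAut.conjNormal x) := MulEquiv.ext hx
    have hct : Commute φ (MulAut.conjNormal t) := MulEquiv.ext ht
    have hc : Commute φ (MulAut.conjNormal (l : G)) := by
      rw [hij, map_mul, map_pow, map_pow]
      exact (hcx.pow_right i).mul_right (hct.pow_right j)
    exact DFunLike.congr_fun hc.eq a
  choose u v huv using h.exists_decomposition
  let F : G → G := fun g => φ (u g) * v g
  have hF : ∀ (q : Q) (l : L), F (q * l) = φ q * l := by
    intro q l
    obtain ⟨h1, h2⟩ := h.decomposition_unique (huv (q * l))
    change (φ (u _) : G) * v _ = _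
    rw [← h1, ← h2]
  have hmul : ∀ g k, F (g * k) = F g * F k := by
    intro g k
    have h1 : g * k = (u g * MulAut.conjNormal (v g : G) (u k) : Q) * (v g * v k : L) := by
      conv_lhs => rw [huv g, huv k]
      simp only [Subgroup.coe_mul, MulAut.conjNormal_apply]
      group
    rw [h1, hF, map_mul, hl]
    simp only [Subgroup.coe_mul, MulAut.conjNormal_apply, F]
    group
  have hF1 : ∀ q : Q, F q = φ q := fun q => by simpa using hF q 1
  have hF2 : ∀ l : L, F l = l := fun l => by simpa using hF 1 l
  let Φ : MulAut G := MulEquiv.ofBijective (MonoidHom.mk' F hmul) (by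
    have := h.finite
    refine Finite.injective_iff_bijective.1 ?_
    rw [injective_iff_map_eq_one]
    intro g hg
    change (φ (u g) : G) * v g = 1 at hg
    obtain ⟨h1, h2⟩ := h.decomposition_unique (q' := 1) (l' := 1) (hg.trans (by simp))
    rw [EmbeddingLike.map_eq_one_iff] at h1
    rw [huv g, h1, h2]
    simp)
  refine ⟨⟨Φ, fun l hl => hF2 ⟨l, hl⟩⟩, ?_⟩
  ext a
  exact hF1 a

theorem restrictQ_mem_fixedSubgroup (α : autCentralizer L) {e : Q}
    (he : e ∈ fixedSubgroup (MulAut.conjNormal t : MulAut Q)) :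
    h.restrictQ α e ∈ fixedSubgroup (MulAut.conjNormal t : MulAut Q) := by
  rw [mem_fixedSubgroup] at *
  rw [← h.restrictQ_conjNormal α h.t_mem, he]

/-- Restriction to `C_Q(t)` of the automorphisms centralising `L`. -/
def restrictFixed :
    autCentralizer L →* MulAut (fixedSubgroup (MulAut.conjNormal t : MulAut Q)) :=
  restrictHom h.restrictQ _ fun α _ he => h.restrictQ_mem_fixedSubgroup α he

theorem restrictFixed_apply (α : autCentralizer L)
    (e : fixedSubgroup (MulAut.conjNormal t : MulAut Q)) :
    (h.restrictFixed α e : Q) = h.restrictQ α e := rfl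

/-- This identifies C with Aut(C_Q(t)). Elements of C commute with the action of `x` and `t` on Q,
so they are determined by their restriction to C_Q(t), and every automorphism of C_Q(t) extends
first to Q and then to G. -/
theorem restrictFixed_bijective : Function.Bijective h.restrictFixed := by
  have hfin := h.finite_Q
  have hc := h.isFixedPointFreeAction
  constructor
  · rw [injective_iff_map_eq_one]
    intro α hα
    have h1 : h.restrictQ α = 1 := by
      refine hc.eq_one_of_fixed _ (h.restrictQ_conjNormal α h.x_mem) fun e he => ?_
      have := DFunLike.congr_fun hα ⟨e, he⟩
      exact congrArg Subtype.val this
    refine Subtype.ext (h.eq_of_eqOn α.2 (Subgroup.one_mem _) fun a ha => ?_)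
    exact congrArg Subtype.val (DFunLike.congr_fun h1 ⟨a, ha⟩)
  · intro β
    obtain ⟨φ, hx, ht, hE⟩ := hc.exists_extension β
    obtain ⟨α, rfl⟩ := h.exists_extension φ hx ht
    refine ⟨α, ?_⟩
    ext1 e
    exact Subtype.ext (hE e)

/-! ### Outer automorphisms -/

/-- Modulo Q the centralizer of an element of order three in L₂(2) is generated by it, and inside Q
nothing but 1 commutes with `x`. -/
theorem exists_pow_of_commute {g : G} (hg : g * x = x * g) : ∃ i < 3, g = x ^ i := by
  obtain ⟨i, hi, j, hj, hij⟩ := h.exists_map_eq g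
  have h1 : j = 0 := by
    have h2 := congrArg (fun k => (π k : Matrix (Fin 2) (Fin 2) (ZMod 2))) hg
    simp only [map_mul, hij, map_pow, Units.val_mul, Units.val_pow_eq_pow_val, h.map_x,
      h.map_t] at h2
    clear hij
    revert i j
    decide
  subst h1
  refine ⟨i, hi, ?_⟩
  have h2 : g * (x ^ i)⁻¹ ∈ Q := by
    rw [← h.map_eq_one, map_mul, map_inv, hij, pow_zero, mul_one, mul_inv_cancel]
  refine mul_inv_eq_one.1 (h.eq_one_of_commute_x h2 ?_)
  calc x * (g * (x ^ i)⁻¹) * x⁻¹ = (x * g) * (x ^ i)⁻¹ * x⁻¹ := by group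
    _ = (g * x) * (x ^ i)⁻¹ * x⁻¹ := by rw [hg]
    _ = _ := by group

omit [Q.Normal] in
theorem x_ne_one : x ≠ 1 := by
  rintro rfl
  have := h.map_x
  rw [map_one] at this
  revert this
  decide

omit [Q.Normal] in
open scoped Pointwise in
-- The order of G is 2^(3+2m) · 3, so ⟨x⟩ and ⟨α x⟩ are both Sylow 3-subgroups.
theorem exists_conj_map_x_mem_zpowers (α : MulAut G) :
    ∃ g : G, g * α x * g⁻¹ ∈ Subgroup.zpowers x := by
  have := h.finite
  have h3 : Fact (Nat.Prime 3) := ⟨Nat.prime_three⟩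
  have hx : orderOf x = 3 := orderOf_eq_prime h.x_cube h.x_ne_one
  have hcard : Nat.card G = 2 ^ (3 + 2 * m) * 3 := by
    rw [← h.isComplement.card_mul_card, h.card_L, h.biextraspecial.card_eq]
    ring
  have hfac : (Nat.card G).factorization 3 = 1 := by
    have h2 : (2 ^ (3 + 2 * m)).factorization 3 = 0 :=
      Nat.factorization_eq_zero_of_not_dvd fun hd =>
        absurd (Nat.prime_three.dvd_of_dvd_pow hd) (by decide)
    rw [hcard, Nat.factorization_mul (by positivity) (by decide), Finsupp.add_apply, h2,
      Nat.Prime.factorization_self Nat.prime_three]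
  let P₁ : Sylow 3 G := Sylow.ofCard (Subgroup.zpowers x) (by
    rw [hfac, Nat.card_zpowers, hx, pow_one])
  let P₂ : Sylow 3 G := Sylow.ofCard (Subgroup.zpowers (α x)) (by
    rw [hfac, Nat.card_zpowers, MulEquiv.orderOf_eq α x, hx, pow_one])
  obtain ⟨g, hg⟩ := MulAction.exists_smul_eq G P₂ P₁
  refine ⟨g, ?_⟩
  have h1 : (P₁ : Subgroup G) = MulAut.conj g • (P₂ : Subgroup G) := by
    rw [← hg, Sylow.coe_subgroup_smul]
  have h2 : MulAut.conj g • (α x) ∈ MulAut.conj g • (P₂ : Subgroup G) :=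
    Subgroup.smul_mem_pointwise_smul _ _ _ (Subgroup.mem_zpowers (α x))
  rw [← h1] at h2
  exact h2

theorem exists_conj_mul_mem (α : MulAut G) :
    ∃ g : G, MulAut.conj g * α ∈ autCentralizer L := by
  classical
  have := h.finite
  have hsuff : ∀ β : MulAut G, (∃ g : G, MulAut.conj g * (β * α) ∈ autCentralizer L) →
      β ∈ Inn G → ∃ g : G, MulAut.conj g * α ∈ autCentralizer L := by
    rintro _ ⟨g, hg⟩ ⟨k, rfl⟩
    refine ⟨g * k, ?_⟩
    rwa [map_mul, mul_assoc]
  -- adjust the image of `x`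
  obtain ⟨k, hk⟩ : ∃ k : G, k * α x * k⁻¹ = x := by
    obtain ⟨g, hg⟩ := h.exists_conj_map_x_mem_zpowers α
    rw [mem_zpowers_iff_mem_range_orderOf, orderOf_eq_prime h.x_cube h.x_ne_one] at hg
    simp only [Finset.mem_image, Finset.mem_range] at hg
    obtain ⟨i, hi, hgi⟩ := hg
    have hcases : i = 0 ∨ i = 1 ∨ i = 2 := by omega
    rcases hcases with rfl | rfl | rfl
    · rw [pow_zero, eq_mul_inv_iff_mul_eq, one_mul, left_eq_mul, EmbeddingLike.map_eq_one_iff] at hgi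
      exact absurd hgi h.x_ne_one
    · exact ⟨g, by rw [← hgi, pow_one]⟩
    -- Conjugation by `t` inverts `x`, which turns x² into `x`.
    · refine ⟨t * g, ?_⟩
      have h1 : t * g * α x * (t * g)⁻¹ = t * x ^ 2 * t⁻¹ := by rw [hgi]; group
      rw [h1, ← h.t_inv_conj_x]
      group
  refine hsuff (MulAut.conj k) ?_ ⟨k, rfl⟩
  obtain ⟨β, hβ⟩ : ∃ β, β = MulAut.conj k * α := ⟨_, rfl⟩
  rw [← hβ]
  have hβx : β x = x := by rw [hβ]; exact hk
  -- adjust the image of `t`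
  obtain ⟨i, hi, hti⟩ := h.exists_pow_of_commute (g := t⁻¹ * β t) (by
    have h1 : β t * x = x ^ 2 * β t := by
      conv_lhs => rw [← hβx]
      rw [← map_mul, h.t_x, map_mul, map_pow, hβx]
    have h2 : t⁻¹ * x ^ 2 = x * t⁻¹ := by
      rw [← h.t_inv_conj_x, h.t_inv]
      have := h.t_sq
      rw [sq] at this
      rw [← mul_assoc, ← mul_assoc, this, one_mul]
    rw [mul_assoc, h1, ← mul_assoc, h2, mul_assoc])
  have hβt : β t = t * x ^ i := by rw [← hti]; group
  refine ⟨(x ^ i)⁻¹, h.mem_autCentralizer.2 ⟨?_, ?_⟩⟩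
  · rw [MulAut.mul_apply, hβx, MulAut.conj_apply]
    group
  · rw [MulAut.mul_apply, hβt, MulAut.conj_apply, inv_inv]
    have h1 : t * x ^ i = x ^ (2 * i) * t := by
      have hs : SemiconjBy t x (x ^ 2) := h.t_x
      rw [pow_mul]
      exact (hs.pow_right i).eq
    have h2 : x ^ (3 * i) = 1 := by rw [pow_mul, h.x_cube, one_pow]
    calc (x ^ i)⁻¹ * (t * x ^ i) * x ^ i = (x ^ i)⁻¹ * (x ^ (2 * i) * t) * x ^ i := by rw [h1]
      _ = x ^ i * (t * x ^ i) := by rw [two_mul, pow_add]; group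
      _ = x ^ (3 * i) * t := by rw [h1, ← mul_assoc, ← pow_add]; congr 2; ring
      _ = t := by rw [h2, one_mul]

end IsFrame

theorem exists_autCentralizer_mulEquiv_out {G : Type*} [Group G] {Q L : Subgroup G} [Q.Normal]
    {m : ℕ} {π : G →* GL (Fin 2) (ZMod 2)} {x t : G} (h : IsFrame Q L m π x t) :
    ∃ e : autCentralizer L ≃* Out G, ∀ α, e α = QuotientGroup.mk (α : MulAut G) := by
  let F : autCentralizer L →* Out G := (QuotientGroup.mk' (Inn G)).comp (autCentralizer L).subtype
  refine ⟨MulEquiv.ofBijective F ⟨?_, ?_⟩, fun _ => rfl⟩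
  · rw [injective_iff_map_eq_one]
    rintro ⟨α, hα⟩ hF
    obtain ⟨g, rfl⟩ := (QuotientGroup.eq_one_iff α).1 hF
    have hα' := h.mem_autCentralizer.1 hα
    rw [MulAut.conj_apply, MulAut.conj_apply, mul_inv_eq_iff_eq_mul,
      mul_inv_eq_iff_eq_mul] at hα'
    -- An element centralizing `x` and `t` is a power of `x` commuting with `t`, hence trivial.
    obtain ⟨i, hi, rfl⟩ := h.exists_pow_of_commute hα'.1
    have h1 : x ^ i = 1 := by
      refine h.eq_of_map_eq (L.pow_mem h.x_mem i) L.one_mem ?_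
      have h2 := congrArg (fun k => (π k : Matrix (Fin 2) (Fin 2) (ZMod 2))) hα'.2
      simp only [map_mul, map_pow, Units.val_mul, Units.val_pow_eq_pow_val, h.map_x,
        h.map_t] at h2
      ext1
      rw [map_pow, Units.val_pow_eq_pow_val, h.map_x, map_one, Units.val_one]
      clear hF hα hα'
      revert i
      decide
    exact Subtype.ext (show MulAut.conj (x ^ i) = 1 by rw [h1, map_one])
  · intro a
    obtain ⟨α, rfl⟩ := QuotientGroup.mk_surjective a
    obtain ⟨g, hg⟩ := h.exists_conj_mul_mem α
    refine ⟨⟨_, hg⟩, ?_⟩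
    change ((MulAut.conj g * α : MulAut G) : Out G) = α
    rw [QuotientGroup.mk_mul, (QuotientGroup.eq_one_iff (MulAut.conj g)).2
      (show MulAut.conj g ∈ Inn G from ⟨g, rfl⟩), one_mul]

/-! ### Dents and the fixed points of `t` -/

theorem exists_module_of_surjective {A S : Type*} [Group A] (N : Subgroup A) [N.Normal]
    (hN : ∀ a : A, a ^ 2 ∈ N) (δ : A → S) (hδ : Function.Surjective δ)
    (hiff : ∀ a b, δ a = δ b ↔ a⁻¹ * b ∈ N) :
    ∃ (_ : AddCommGroup S) (_ : Module (ZMod 2) S) (p : A →* Multiplicative S),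
      ∀ a, (p a).toAdd = δ a := by
  have hsq : ∀ a : A ⧸ N, a ^ 2 = 1 := by
    intro a
    obtain ⟨a, rfl⟩ := QuotientGroup.mk_surjective a
    rw [← QuotientGroup.mk_pow, QuotientGroup.eq_one_iff]
    exact hN a
  let _ : CommGroup (A ⧸ N) := commGroupOfSq hsq
  let _ : Module (ZMod 2) (Additive (A ⧸ N)) := moduleOfSq hsq
  let σ : S → Additive (A ⧸ N) := fun s =>
    Additive.ofMul ((Function.surjInv hδ s : A) : A ⧸ N)
  have hσ : ∀ a, σ (δ a) = Additive.ofMul (a : A ⧸ N) := by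
    intro a
    refine congrArg Additive.ofMul (QuotientGroup.eq.2 ?_)
    rw [← hiff]
    exact Function.surjInv_eq hδ _
  have hbij : Function.Bijective σ := by
    constructor
    · intro s s' hss
      obtain ⟨a, rfl⟩ := hδ s
      obtain ⟨b, rfl⟩ := hδ s'
      rw [hσ, hσ] at hss
      exact (hiff a b).2 (QuotientGroup.eq.1 (Additive.ofMul.injective hss))
    · intro b
      obtain ⟨a, ha⟩ := QuotientGroup.mk_surjective b.toMul
      exact ⟨δ a, by rw [hσ, ha, ofMul_toMul]⟩
  -- δ identifies S with A/N, and the vector space structure of A/N is transported along this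
  -- bijection.
  let eqv : S ≃ Additive (A ⧸ N) := Equiv.ofBijective σ hbij
  let _ : AddCommGroup S := eqv.addCommGroup
  refine ⟨inferInstance, eqv.module (ZMod 2), MonoidHom.mk' (fun a => Multiplicative.ofAdd (δ a)) ?_,
    fun _ => rfl⟩
  intro a b
  have h1 : δ (a * b) = δ a + δ b := by
    apply eqv.injective
    rw [Equiv.add_def, Equiv.apply_symm_apply]
    change σ _ = σ _ + σ _
    rw [hσ, hσ, hσ]
    rfl
  rw [h1]
  rfl

/-- The projection of a dent onto its image modulo the centre. -/
def Dent.toBar {G : Type*} [Group G] {Q : Subgroup G} [Q.Normal] (D : Dent Q) :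
    D.carrier →* D.bar :=
  (QuotientGroup.mk' (centre Q)).subgroupMap D.carrier

theorem Dent.toBar_surjective {G : Type*} [Group G] {Q : Subgroup G} [Q.Normal] (D : Dent Q) :
    Function.Surjective D.toBar :=
  MonoidHom.subgroupMap_surjective _ _

theorem Dent.toBar_coe {G : Type*} [Group G] {Q : Subgroup G} [Q.Normal] (D : Dent Q)
    (a : D.carrier) : (D.toBar a : G ⧸ centre Q) = ((a : G) : G ⧸ centre Q) := rfl

theorem Dent.toBar_eq_one {G : Type*} [Group G] {Q : Subgroup G} [Q.Normal] (D : Dent Q)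
    (a : D.carrier) : D.toBar a = 1 ↔ (a : G) ∈ centre Q := by
  rw [← QuotientGroup.eq_one_iff, ← D.toBar_coe, OneMemClass.coe_eq_one]

theorem Dent.mem_of_mk_eq {G : Type*} [Group G] {Q : Subgroup G} [Q.Normal] (D : Dent Q)
    {a b : G} (hb : b ∈ D.carrier) (hab : (a : G ⧸ centre Q) = b) : a ∈ D.carrier := by
  have h1 := D.centre_lt.le (QuotientGroup.eq.1 hab)
  have h2 := D.carrier.mul_mem hb (D.carrier.inv_mem h1)
  have h3 : b * (a⁻¹ * b)⁻¹ = a := by group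
  rwa [h3] at h2

namespace IsFrame

variable {G : Type*} [Group G] {Q L : Subgroup G} [Q.Normal] {m : ℕ}
  {π : G →* GL (Fin 2) (ZMod 2)} {x t : G} (h : IsFrame Q L m π x t)
include h

theorem isNaturalSection_dent (D : Dent Q) : IsNaturalSection π (centre Q) D.carrier :=
  h.natural_factor _ _ inferInstance D.normal le_rfl D.centre_lt D.lt.le
    fun N hN h1 h2 => D.irreducible N hN h1 h2

theorem exists_isModuleIso (D₁ D₂ : Dent Q) : ∃ φ : D₁.bar ≃* D₂.bar, IsModuleIso φ := by
  have hD : ∀ D : Dent Q, ∃ e : D.bar ≃* Multiplicative (Fin 2 → ZMod 2), ∀ (g : G)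
      (b b' : D.carrier), (b' : G) = g * b * g⁻¹ → (e (D.toBar b')).toAdd =
        Matrix.mulVec (π g : Matrix (Fin 2) (Fin 2) (ZMod 2)) (e (D.toBar b)).toAdd := by
    intro D
    obtain ⟨f, hsurj, hker, heq⟩ := h.isNaturalSection_dent D
    obtain ⟨e, he⟩ := exists_mulEquiv_of_ker_iff D.toBar f D.toBar_surjective hsurj fun a => by
      rw [D.toBar_eq_one, ← MonoidHom.mem_ker, hker, Subgroup.mem_subgroupOf]
    refine ⟨e, fun g b b' hb => ?_⟩
    rw [he, he]
    exact heq g b b' hb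
  obtain ⟨e₁, he₁⟩ := hD D₁
  obtain ⟨e₂, he₂⟩ := hD D₂
  refine ⟨e₁.trans e₂.symm, fun g u u' hu => ?_⟩
  obtain ⟨a, rfl⟩ := D₁.toBar_surjective u
  obtain ⟨b, hb⟩ := D₂.toBar_surjective ((e₁.trans e₂.symm) (D₁.toBar a))
  let a' : D₁.carrier := ⟨g * a * g⁻¹, D₁.normal.conj_mem a a.2 g⟩
  let b' : D₂.carrier := ⟨g * b * g⁻¹, D₂.normal.conj_mem b b.2 g⟩
  have hu' : u' = D₁.toBar a' := Subtype.ext hu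
  have hb2 : e₂ (D₂.toBar b) = e₁ (D₁.toBar a) := by
    rw [hb, MulEquiv.trans_apply, MulEquiv.apply_symm_apply]
  have h1 : (e₁.trans e₂.symm) u' = D₂.toBar b' := by
    rw [MulEquiv.trans_apply, MulEquiv.symm_apply_eq, hu']
    apply Multiplicative.toAdd.injective
    rw [he₁ g a a' rfl, he₂ g b b' rfl, hb2]
  rw [h1, ← hb]
  rfl

omit [Q.Normal] in
theorem card_centre : Nat.card (centre Q) = 4 := by
  obtain ⟨f, hsurj, hker, -⟩ := h.natural_centre
  have hinj : Function.Injective f := by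
    rw [← MonoidHom.ker_eq_bot_iff, hker]
    simp
  rw [Nat.card_eq_of_bijective f ⟨hinj, hsurj⟩]
  simp [Nat.card_eq_fintype_card]

theorem card_dent (D : Dent Q) : Nat.card D.carrier = 2 ^ 4 := by
  obtain ⟨f, hsurj, hker, -⟩ := h.isNaturalSection_dent D
  have h1 := f.ker.card_mul_index
  have h2 : Nat.card (Multiplicative (Fin 2 → ZMod 2)) = 4 := by
    simp [Nat.card_eq_fintype_card]
  rw [Subgroup.index_ker, MonoidHom.range_eq_top.2 hsurj, Subgroup.card_top, h2, hker,
    Nat.card_congr (Subgroup.subgroupOfEquivOfLe D.centre_lt.le).toEquiv, h.card_centre] at h1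
  rw [← h1]
  rfl

variable [Finite Q]

/-- The subgroup of `Q` generated by the centre and the conjugates of `e`. -/
def natSubgroup (e : Q) : Subgroup G :=
  (h.isFixedPointFreeAction.natSubgroup e).map Q.subtype

theorem coe_mem_natSubgroup {e a : Q} :
    (a : G) ∈ h.natSubgroup e ↔ a ∈ h.isFixedPointFreeAction.natSubgroup e :=
  Subgroup.mem_map_iff_mem Q.subtype_injective

theorem natSubgroup_le_Q (e : Q) : h.natSubgroup e ≤ Q := Subgroup.map_subtype_le _

theorem centre_le_natSubgroup (e : Q) : centre Q ≤ h.natSubgroup e :=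
  Subgroup.map_mono (h.isFixedPointFreeAction.center_le_natSubgroup e)

theorem self_mem_natSubgroup (e : Q) : (e : G) ∈ h.natSubgroup e :=
  h.coe_mem_natSubgroup.2 (h.isFixedPointFreeAction.self_mem_natSubgroup e)

theorem natSubgroup_normal {e : Q}
    (he : e ∈ fixedSubgroup (MulAut.conjNormal t : MulAut Q)) : (h.natSubgroup e).Normal := by
  have hc := h.isFixedPointFreeAction
  let M : Submonoid G :=
    { carrier := {g | ∀ a ∈ hc.natSubgroup e, MulAut.conjNormal g a ∈ hc.natSubgroup e}
      one_mem' := fun a ha => by rwa [map_one, MulAut.one_apply]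
      mul_mem' := fun {g k} hg hk a ha => by
        rw [map_mul, MulAut.mul_apply]
        exact hg _ (hk _ ha) }
  have hM : ∀ g, g ∈ M := h.mem_of_generators M
    (fun b hb a ha => hc.conj_mem_natSubgroup ⟨b, hb⟩ ha)
    (fun a ha => hc.X_mem_natSubgroup ha) (fun a ha => hc.T_mem_natSubgroup he ha)
  refine ⟨?_⟩
  rintro _ ⟨a, ha, rfl⟩ g
  exact ⟨_, hM g a ha, rfl⟩

/-- Elements of the dent of `e` are conjugates of `e`, up to central elements. -/
theorem natSubgroup_cases {e : Q} {g : G} (hg : g ∈ h.natSubgroup e) :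
    g ∈ centre Q ∨ ∃ k : G, (g : G ⧸ centre Q) = (k * e * k⁻¹ : G) := by
  obtain ⟨a, ha, rfl⟩ := hg
  obtain ⟨c, hcZ, hcases⟩ := h.isFixedPointFreeAction.natSubgroup_cases ha
  have hcc : ((c : G) : G ⧸ centre Q) = 1 := (QuotientGroup.eq_one_iff _).2 (mem_centre_coe.2 hcZ)
  have key : ∀ b : Q, ((c * b : Q) : G ⧸ centre Q) = (b : G) := fun b => by
    rw [Subgroup.coe_mul, QuotientGroup.mk_mul, hcc, one_mul]
  rcases hcases with rfl | rfl | rfl | rfl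
  · exact Or.inl (mem_centre_coe.2 hcZ)
  · exact Or.inr ⟨1, by simpa using key e⟩
  · exact Or.inr ⟨x, key _⟩
  · refine Or.inr ⟨x * x, (key _).trans ?_⟩
    rw [MulAut.conjNormal_apply, MulAut.conjNormal_apply]
    congr 1
    group

/-- The dent generated by a noncentral fixed point of `t`. -/
def dentOf (e : Q) (he : e ∈ fixedSubgroup (MulAut.conjNormal t : MulAut Q))
    (heZ : e ∉ Subgroup.center Q) : Dent Q where
  carrier := h.natSubgroup e
  normal := h.natSubgroup_normal he
  centre_lt := SetLike.lt_iff_le_and_exists.2 ⟨h.centre_le_natSubgroup e, (e : G),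
    h.self_mem_natSubgroup e, fun hZ => heZ (mem_centre_coe.1 hZ)⟩
  lt := by
    -- Everything in the subgroup generated by Z, e and Xe commutes with e, so it cannot be all of Q
    -- when e is noncentral.
    refine lt_of_le_of_ne (h.natSubgroup_le_Q e) fun heq => heZ ?_
    rw [Subgroup.mem_center_iff]
    intro a
    have ha : a ∈ h.isFixedPointFreeAction.natSubgroup e := by
      rw [← h.coe_mem_natSubgroup, heq]
      exact a.2
    exact h.isFixedPointFreeAction.natSubgroup_commute (Commute.refl e) ha
      (h.isFixedPointFreeAction.self_mem_natSubgroup e)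
  irreducible := by
    have hc := h.isFixedPointFreeAction
    intro N hN hZN hNe
    by_cases hNZ : N ≤ centre Q
    · exact Or.inl (le_antisymm hNZ hZN)
    · right
      obtain ⟨n, hn, hnZ⟩ := SetLike.not_le_iff_exists.1 hNZ
      obtain ⟨a, ha, rfl⟩ := hNe hn
      refine le_antisymm hNe ?_
      have h1 : hc.natSubgroup e ≤ N.comap Q.subtype := by
        refine hc.natSubgroup_le_of_mem (n := a) ?_ ?_ hn ha fun haZ => hnZ (mem_centre_coe.2 haZ)
        · exact fun c hcZ => hZN (mem_centre_coe.2 hcZ)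
        · exact fun b hb => hN.conj_mem b hb x
      exact Subgroup.map_le_iff_le_comap.2 h1

/-- The vector (1, 1) of the natural module D/Z is fixed by `t`. It lifts to an element of D fixed
by `t`, which generates D by irreducibility. -/
theorem exists_eq_dentOf (D : Dent Q) : ∃ e he heZ, D = h.dentOf e he heZ := by
  have hc := h.isFixedPointFreeAction
  obtain ⟨f, hsurj, hker, heq⟩ := h.isNaturalSection_dent D
  have hmem : ∀ c : D.carrier, f c = 1 ↔ (c : G) ∈ centre Q := fun c => by
    rw [← MonoidHom.mem_ker, hker, Subgroup.mem_subgroupOf]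
  obtain ⟨d, hd⟩ := hsurj (Multiplicative.ofAdd ![1, 1])
  have hdQ : (d : G) ∈ Q := D.lt.le d.2
  have hT : MulAut.conjNormal t (⟨d, hdQ⟩ : Q) * (⟨d, hdQ⟩ : Q)⁻¹ ∈ Subgroup.center Q := by
    let d' : D.carrier := ⟨t * d * t⁻¹, D.normal.conj_mem d d.2 t⟩
    have h1 : f (d' * d⁻¹) = 1 := by
      rw [map_mul, map_inv, mul_inv_eq_one]
      apply Multiplicative.toAdd.injective
      rw [heq t d d' rfl, h.map_t, hd]
      decide
    exact mem_centre_coe.1 ((hmem _).1 h1)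
  have hdZ : (d : G) ∉ centre Q := by
    rw [← hmem, hd]
    decide
  obtain ⟨c, hcZ, he⟩ := hc.exists_fixed_mul hT
  have heD : ((⟨d, hdQ⟩ * c : Q) : G) ∈ D.carrier :=
    D.carrier.mul_mem d.2 (D.centre_lt.le (mem_centre_coe.2 hcZ))
  have heZ : (⟨d, hdQ⟩ * c : Q) ∉ Subgroup.center Q := fun h1 => hdZ (mem_centre_coe.2
    ((Subgroup.mul_mem_cancel_right _ hcZ).1 h1) : _)
  refine ⟨_, he, heZ, ?_⟩
  have hle : (h.dentOf _ he heZ).carrier ≤ D.carrier := by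
    have h1 : hc.natSubgroup (⟨d, hdQ⟩ * c) ≤ D.carrier.comap Q.subtype :=
      hc.natSubgroup_le (fun z hz => D.centre_lt.le (mem_centre_coe.2 hz)) heD
        (D.normal.conj_mem _ heD x)
    exact Subgroup.map_le_iff_le_comap.2 h1
  ext1
  rcases D.irreducible _ (h.natSubgroup_normal he) (h.centre_le_natSubgroup _) hle with h1 | h1
  · exact absurd (h1 ▸ h.self_mem_natSubgroup _) fun h2 => heZ (mem_centre_coe.1 h2)
  · exact h1.symm

theorem dentOf_eq_iff {e f : Q} (he heZ) (hf hfZ) :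
    h.dentOf e he heZ = h.dentOf f hf hfZ ↔ e⁻¹ * f ∈ Subgroup.center Q := by
  rw [Dent.ext_iff, ← h.isFixedPointFreeAction.natSubgroup_eq_iff he hf]
  exact (Subgroup.map_injective Q.subtype_injective).eq_iff

/-! ### Diagonal dents -/

/-- An isomorphism of modules sends the only nontrivial coset fixed by `t` to the only such coset,
so eZ goes to fZ, and equivariance fixes the values at all conjugates. In particular the isomorphism
is unique. -/
theorem isModuleIso_apply {e f : Q} {he heZ hf hfZ}
    (φ : (h.dentOf e he heZ).bar ≃* (h.dentOf f hf hfZ).bar) (hφ : IsModuleIso φ) (k : G)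
    (u : (h.dentOf e he heZ).bar) (hu : (u : G ⧸ centre Q) = (k * e * k⁻¹ : G)) :
    (φ u : G ⧸ centre Q) = (k * f * k⁻¹ : G) := by
  let D₁ := h.dentOf e he heZ
  let D₂ := h.dentOf f hf hfZ
  let e' : D₁.carrier := ⟨e, h.self_mem_natSubgroup e⟩
  have hte : t * (e : G) * t⁻¹ = e := congrArg Subtype.val he
  have h1 : (φ (D₁.toBar e') : G ⧸ centre Q) = (f : G) := by
    obtain ⟨b, hb⟩ := D₂.toBar_surjective (φ (D₁.toBar e'))
    have h2 := hφ t (D₁.toBar e') (D₁.toBar e') (by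
      rw [D₁.toBar_coe, ← QuotientGroup.mk_mul, ← QuotientGroup.mk_inv, ← QuotientGroup.mk_mul]
      exact congrArg _ hte.symm)
    rw [← hb, D₂.toBar_coe, ← QuotientGroup.mk_mul, ← QuotientGroup.mk_inv,
      ← QuotientGroup.mk_mul] at h2
    have hbQ : (b : G) ∈ Q := h.natSubgroup_le_Q f b.2
    have hbT : MulAut.conjNormal t (⟨b, hbQ⟩ : Q) * (⟨b, hbQ⟩ : Q)⁻¹ ∈ Subgroup.center Q := by
      rw [← mem_centre_coe, ← QuotientGroup.eq_one_iff]
      change ((t * b * t⁻¹ * (b : G)⁻¹ : G) : G ⧸ centre Q) = 1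
      rw [QuotientGroup.mk_mul, ← h2, ← QuotientGroup.mk_mul, mul_inv_cancel]
      rfl
    rcases h.isFixedPointFreeAction.natSubgroup_fixed hf
      (h.coe_mem_natSubgroup.1 b.2 : (⟨b, hbQ⟩ : Q) ∈ _) hbT with h3 | h3
    · have h4 : φ (D₁.toBar e') = 1 := by
        rw [← hb, D₂.toBar_eq_one]
        exact mem_centre_coe.2 h3
      rw [EmbeddingLike.map_eq_one_iff, D₁.toBar_eq_one] at h4
      exact absurd (mem_centre_coe.1 h4) heZ
    · rw [← mem_centre_coe, ← QuotientGroup.eq_one_iff] at h3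
      change ((b * (f : G)⁻¹ : G) : G ⧸ centre Q) = 1 at h3
      rw [← hb, D₂.toBar_coe]
      rw [QuotientGroup.mk_mul, QuotientGroup.mk_inv, mul_inv_eq_one] at h3
      exact h3
  rw [hφ k (D₁.toBar e') u hu, h1]
  rfl

theorem isDiagonal_dentOf {e f : Q} {he heZ hf hfZ} (hef hefZ) :
    IsDiagonal (h.dentOf e he heZ) (h.dentOf f hf hfZ) (h.dentOf (e * f) hef hefZ) := by
  obtain ⟨φ, hφ⟩ := h.exists_isModuleIso (h.dentOf e he heZ) (h.dentOf f hf hfZ)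
  refine ⟨φ, hφ, fun g => ⟨fun hg => ?_, ?_⟩⟩
  · rcases h.natSubgroup_cases hg with h1 | ⟨k, h1⟩
    · refine ⟨1, ?_⟩
      rw [map_one, OneMemClass.coe_one, OneMemClass.coe_one, one_mul]
      exact (QuotientGroup.eq_one_iff g).2 h1
    · let u := (h.dentOf e he heZ).toBar
        ⟨k * e * k⁻¹, (h.natSubgroup_normal he).conj_mem _ (h.self_mem_natSubgroup e) k⟩
      refine ⟨u, ?_⟩
      rw [h.isModuleIso_apply φ hφ k u rfl, h1, Dent.toBar_coe, ← QuotientGroup.mk_mul]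
      congr 1
      rw [Subgroup.coe_mul]
      group
  · rintro ⟨u, hu⟩
    obtain ⟨a, rfl⟩ := Dent.toBar_surjective _ u
    rcases h.natSubgroup_cases a.2 with h1 | ⟨k, h1⟩
    · rw [((h.dentOf e he heZ).toBar_eq_one a).2 h1, map_one, OneMemClass.coe_one,
        OneMemClass.coe_one, one_mul, QuotientGroup.eq_one_iff] at hu
      exact h.centre_le_natSubgroup _ hu
    · rw [h.isModuleIso_apply φ hφ k _ h1, Dent.toBar_coe, h1, ← QuotientGroup.mk_mul] at hu
      refine Dent.mem_of_mk_eq _ ?_ hu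
      have h2 : k * (e : G) * k⁻¹ * (k * f * k⁻¹) = k * (e * f : Q) * k⁻¹ := by
        rw [Subgroup.coe_mul]
        group
      rw [h2]
      exact (h.natSubgroup_normal hef).conj_mem _ (h.self_mem_natSubgroup _) k

theorem mul_mem_of_isDiagonal {e f : Q} {he heZ hf hfZ} {D : Dent Q}
    (hD : IsDiagonal (h.dentOf e he heZ) (h.dentOf f hf hfZ) D) : (e * f : G) ∈ D.carrier := by
  obtain ⟨φ, hφ, hD⟩ := hD
  let u := (h.dentOf e he heZ).toBar ⟨e, h.self_mem_natSubgroup e⟩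
  refine (hD _).2 ⟨u, ?_⟩
  rw [h.isModuleIso_apply φ hφ 1 u (by simp [u, Dent.toBar_coe]), Dent.toBar_coe]
  simp

/-! ### The dent space -/

open Classical in
/-- The element of the dent space represented by a fixed point of `t`. -/
noncomputable def toDentSpace (e : fixedSubgroup (MulAut.conjNormal t : MulAut Q)) :
    DentSpace Q :=
  if he : (e : Q) ∈ Subgroup.center Q then .zero else .ofDent (h.dentOf e e.2 he)

theorem toDentSpace_of_mem {e : fixedSubgroup (MulAut.conjNormal t : MulAut Q)}
    (he : (e : Q) ∈ Subgroup.center Q) : h.toDentSpace e = .zero := dif_pos he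

theorem toDentSpace_of_notMem {e : fixedSubgroup (MulAut.conjNormal t : MulAut Q)}
    (he : (e : Q) ∉ Subgroup.center Q) : h.toDentSpace e = .ofDent (h.dentOf e e.2 he) :=
  dif_neg he

theorem toDentSpace_eq_zero {e : fixedSubgroup (MulAut.conjNormal t : MulAut Q)} :
    h.toDentSpace e = .zero ↔ (e : Q) ∈ Subgroup.center Q := by
  by_cases he : (e : Q) ∈ Subgroup.center Q
  · simp [he, h.toDentSpace_of_mem he]
  · simp [he, h.toDentSpace_of_notMem he]

theorem toDentSpace_eq_ofDent {e : fixedSubgroup (MulAut.conjNormal t : MulAut Q)} {D : Dent Q}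
    (he : h.toDentSpace e = .ofDent D) : ∃ heZ, D = h.dentOf e e.2 heZ := by
  by_cases heZ : (e : Q) ∈ Subgroup.center Q
  · rw [h.toDentSpace_of_mem heZ] at he
    cases he
  · rw [h.toDentSpace_of_notMem heZ] at he
    cases he
    exact ⟨heZ, rfl⟩

theorem toDentSpace_surjective : Function.Surjective h.toDentSpace := by
  rintro (_ | D)
  · exact ⟨1, h.toDentSpace_of_mem (Subgroup.one_mem _)⟩
  · obtain ⟨e, he, heZ, rfl⟩ := h.exists_eq_dentOf D
    exact ⟨⟨e, he⟩, h.toDentSpace_of_notMem heZ⟩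

theorem toDentSpace_eq_iff (e f : fixedSubgroup (MulAut.conjNormal t : MulAut Q)) :
    h.toDentSpace e = h.toDentSpace f ↔ (e : Q)⁻¹ * f ∈ Subgroup.center Q := by
  by_cases he : (e : Q) ∈ Subgroup.center Q
  · rw [h.toDentSpace_of_mem he, eq_comm, h.toDentSpace_eq_zero,
      Subgroup.mul_mem_cancel_left _ (Subgroup.inv_mem _ he)]
  by_cases hf : (f : Q) ∈ Subgroup.center Q
  · rw [h.toDentSpace_of_mem hf, h.toDentSpace_eq_zero, Subgroup.mul_mem_cancel_right _ hf,
      Subgroup.inv_mem_iff]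
  rw [h.toDentSpace_of_notMem he, h.toDentSpace_of_notMem hf, DentSpace.ofDent.injEq,
    h.dentOf_eq_iff]

omit [Finite Q] in
-- The two elements differ by the central factor e²; the inverse-free form is symmetric in e and f.
theorem inv_mul_mem_center_iff (e f : Q) :
    e⁻¹ * f ∈ Subgroup.center Q ↔ e * f ∈ Subgroup.center Q := by
  have h1 : e * f = e ^ 2 * (e⁻¹ * f) := by group
  rw [h1, Subgroup.mul_mem_cancel_left _ (h.isFixedPointFreeAction.sq_mem e)]

theorem isDentSum_toDentSpace (e f : fixedSubgroup (MulAut.conjNormal t : MulAut Q)) :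
    IsDentSum (h.toDentSpace e) (h.toDentSpace f) (h.toDentSpace (e * f)) := by
  by_cases he : (e : Q) ∈ Subgroup.center Q
  · have h1 : h.toDentSpace (e * f) = h.toDentSpace f := by
      rw [toDentSpace_eq_iff, h.inv_mul_mem_center_iff, Subgroup.coe_mul, mul_assoc,
        Subgroup.mul_mem_cancel_left _ he, ← sq]
      exact h.isFixedPointFreeAction.sq_mem _
    rw [h1, h.toDentSpace_of_mem he]
    exact .zero_left _
  by_cases hf : (f : Q) ∈ Subgroup.center Q
  · have h1 : h.toDentSpace (e * f) = h.toDentSpace e := by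
      rw [eq_comm, toDentSpace_eq_iff, Subgroup.coe_mul, inv_mul_cancel_left]
      exact hf
    rw [h1, h.toDentSpace_of_mem hf]
    exact .zero_right _
  by_cases hef : ((e * f : fixedSubgroup (MulAut.conjNormal t : MulAut Q)) : Q) ∈
      Subgroup.center Q
  · have h1 : h.toDentSpace e = h.toDentSpace f := by
      rw [toDentSpace_eq_iff, h.inv_mul_mem_center_iff]
      exact hef
    rw [h.toDentSpace_of_mem hef, ← h1, h.toDentSpace_of_notMem he]
    exact .self _
  rw [h.toDentSpace_of_notMem he, h.toDentSpace_of_notMem hf, h.toDentSpace_of_notMem hef]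
  refine .diagonal _ _ _ (fun heq => hef ?_) (h.isDiagonal_dentOf _ _)
  rw [dentOf_eq_iff, h.inv_mul_mem_center_iff] at heq
  exact heq

/-- Converse of `isDentSum_toDentSpace`: the relation determines its third entry. In the diagonal
case ef is an element of the third dent fixed by `t`, so modulo Z it is either trivial, which would
force the two dents to be equal, or the generator g. -/
theorem toDentSpace_mul_of_isDentSum {e f g : fixedSubgroup (MulAut.conjNormal t : MulAut Q)}
    (hs : IsDentSum (h.toDentSpace e) (h.toDentSpace f) (h.toDentSpace g)) :
    h.toDentSpace (e * f) = h.toDentSpace g := by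
  have hc := h.isFixedPointFreeAction
  rw [toDentSpace_eq_iff, h.inv_mul_mem_center_iff, Subgroup.coe_mul]
  generalize hx : h.toDentSpace e = a at hs
  generalize hy : h.toDentSpace f = b at hs
  generalize hz : h.toDentSpace g = c at hs
  cases hs with
  | zero_left =>
    rw [h.toDentSpace_eq_zero] at hx
    rw [← hz, toDentSpace_eq_iff, h.inv_mul_mem_center_iff] at hy
    rw [mul_assoc, Subgroup.mul_mem_cancel_left _ hx]
    exact hy
  | zero_right =>
    rw [h.toDentSpace_eq_zero] at hy
    rw [← hz, toDentSpace_eq_iff, h.inv_mul_mem_center_iff] at hx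
    have h1 : (e : Q) * f * g = f * (e * g) := by
      rw [← mem_center_comm hy, mul_assoc]
    rw [h1]
    exact Subgroup.mul_mem _ hy hx
  | self D =>
    rw [h.toDentSpace_eq_zero] at hz
    rw [← hy, toDentSpace_eq_iff, h.inv_mul_mem_center_iff] at hx
    exact Subgroup.mul_mem _ hx hz
  | diagonal D₁ D₂ D₃ hne hd =>
    obtain ⟨heZ, rfl⟩ := h.toDentSpace_eq_ofDent hx
    obtain ⟨hfZ, rfl⟩ := h.toDentSpace_eq_ofDent hy
    obtain ⟨hgZ, rfl⟩ := h.toDentSpace_eq_ofDent hz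
    have h1 : (e * f : Q) ∈ hc.natSubgroup g :=
      h.coe_mem_natSubgroup.1 (h.mul_mem_of_isDiagonal hd)
    have h2 : MulAut.conjNormal t (e * f : Q) = e * f := Subgroup.mul_mem _ e.2 f.2
    rcases hc.natSubgroup_fixed g.2 h1 (by
      rw [h2, mul_inv_cancel]; exact Subgroup.one_mem _) with h3 | h3
    · refine absurd ?_ hne
      rw [dentOf_eq_iff, h.inv_mul_mem_center_iff]
      exact h3
    · have h4 : (e * f * g : Q) = e * f * (g : Q)⁻¹ * g ^ 2 := by group
      rw [h4]
      exact Subgroup.mul_mem _ h3 (hc.sq_mem _)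

/-- A dent has order 16, and it has exponent two exactly when its generator e squares to 1. -/
theorem dentQ_toDentSpace (e : fixedSubgroup (MulAut.conjNormal t : MulAut Q)) :
    dentQ (h.toDentSpace e) = nontrivialIndicator (e ^ 2) := by
  have hc := h.isFixedPointFreeAction
  by_cases he : (e : Q) ∈ Subgroup.center Q
  · rw [h.toDentSpace_of_mem he, eq_comm, dentQ, nontrivialIndicator_eq_zero]
    exact Subtype.ext (hc.center_sq _ he)
  · rw [h.toDentSpace_of_notMem he, dentQ]
    have hiff : (h.dentOf e e.2 he).IsSingular ↔ e ^ 2 = 1 := by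
      constructor
      · rintro ⟨φ⟩
        have h1 : ∀ v : Multiplicative (Fin 4 → ZMod 2), v ^ 2 = 1 :=
          IsExtraspecialQuotient.mul_self_quotient
        have h2 : (⟨(e : Q), h.self_mem_natSubgroup e⟩ : (h.dentOf e e.2 he).carrier) ^ 2 = 1 :=
          φ.injective (by rw [map_pow, h1, map_one])
        exact Subtype.ext (Subtype.ext
          (congrArg (Subtype.val : (h.dentOf e e.2 he).carrier → G) h2))
      · intro h1
        refine nonempty_mulEquiv_of_sq_eq_one ?_ 4 (h.card_dent _)
        rintro ⟨_, a, ha, rfl⟩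
        have h2 := hc.natSubgroup_sq (congrArg Subtype.val h1) ha
        exact Subtype.ext (congrArg (Subtype.val : Q → G) h2)
    by_cases h1 : e ^ 2 = 1
    · exact (if_pos (hiff.2 h1)).trans (if_pos h1).symm
    · exact (if_neg (mt hiff.1 h1)).trans (if_neg h1).symm

theorem dentBeta_toDentSpace (e f : fixedSubgroup (MulAut.conjNormal t : MulAut Q)) :
    dentBeta (h.toDentSpace e) (h.toDentSpace f) =
      nontrivialIndicator (e * f * e⁻¹ * f⁻¹) := by
  have hc := h.isFixedPointFreeAction
  have hiff : e * f * e⁻¹ * f⁻¹ = 1 ↔ (e : Q) * f = f * e := by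
    rw [mul_inv_eq_one, mul_inv_eq_iff_eq_mul, Subtype.ext_iff]
    rfl
  by_cases he : (e : Q) ∈ Subgroup.center Q
  · rw [h.toDentSpace_of_mem he, eq_comm, dentBeta, nontrivialIndicator_eq_zero, hiff]
    exact mem_center_comm he _
  by_cases hf : (f : Q) ∈ Subgroup.center Q
  · rw [h.toDentSpace_of_mem hf, h.toDentSpace_of_notMem he, eq_comm, dentBeta,
      nontrivialIndicator_eq_zero, hiff]
    exact (mem_center_comm hf _).symm
  rw [h.toDentSpace_of_notMem he, h.toDentSpace_of_notMem hf, dentBeta]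
  have h1 : (∀ a ∈ (h.dentOf e e.2 he).carrier, ∀ b ∈ (h.dentOf f f.2 hf).carrier,
      a * b = b * a) ↔ e * f * e⁻¹ * f⁻¹ = 1 := by
    rw [hiff]
    constructor
    · intro hab
      exact Subtype.ext (hab _ (h.self_mem_natSubgroup _) _ (h.self_mem_natSubgroup _))
    · rintro hef _ ⟨a, ha, rfl⟩ _ ⟨b, hb, rfl⟩
      exact congrArg Subtype.val (hc.natSubgroup_commute hef ha hb).eq
  by_cases h2 : e * f * e⁻¹ * f⁻¹ = 1
  · exact (if_pos (h1.2 h2)).trans (if_pos h2).symm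
  · exact (if_neg (mt h1.1 h2)).trans (if_neg h2).symm

end IsFrame

/-! ### Isometry groups and the automorphism group of an extraspecial group -/

theorem nonempty_isometryGroup_mulEquiv {K V V' : Type*} [CommRing K] [AddCommGroup V] [Module K V]
    [AddCommGroup V'] [Module K V'] {q : QuadraticForm K V} {q' : QuadraticForm K V'}
    (hq : QuadraticMap.Equivalent q q') : Nonempty (isometryGroup q ≃* isometryGroup q') := by
  obtain ⟨f⟩ := hq
  have hf : ∀ v, q' (f.toLinearEquiv v) = q v := f.map_app
  have hf' : ∀ v, q (f.toLinearEquiv.symm v) = q' v := fun v => by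
    rw [← hf, LinearEquiv.apply_symm_apply]
  refine ⟨
    { toFun := fun g => ⟨f.toLinearEquiv.symm.trans (g.1.trans f.toLinearEquiv), fun v => ?_⟩
      invFun := fun g => ⟨f.toLinearEquiv.trans (g.1.trans f.toLinearEquiv.symm), fun v => ?_⟩
      left_inv := fun g => ?_
      right_inv := fun g => ?_
      map_mul' := fun g k => ?_ }⟩
  · rw [LinearEquiv.trans_apply, LinearEquiv.trans_apply, hf, g.2, hf']
  · rw [LinearEquiv.trans_apply, LinearEquiv.trans_apply, hf', g.2, hf]
  · ext v
    simp
  · ext v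
    simp
  · ext v
    simp [LinearEquiv.mul_apply]

namespace IsExtraspecialQuotient

variable {E W : Type*} [Group E] [AddCommGroup W] [Module (ZMod 2) W]
  {p : E →* Multiplicative W} {z : E}

theorem nondegenerate (h : IsExtraspecialQuotient p z) {q : QuadraticForm (ZMod 2) W}
    (hpol : ∀ e f, QuadraticMap.polar q (p e).toAdd (p f).toAdd =
      nontrivialIndicator (e * f * e⁻¹ * f⁻¹)) (w : W)
    (hw : ∀ v, QuadraticMap.polar q w v = 0) : w = 0 := by
  obtain ⟨e, rfl⟩ := h.exists_toAdd_eq w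
  rw [toAdd_eq_zero, h.map_eq_one_iff_central]
  intro f
  have h1 := hw (p f).toAdd
  rw [hpol, nontrivialIndicator_eq_zero, mul_inv_eq_one, mul_inv_eq_iff_eq_mul] at h1
  exact h1

theorem card_eq (h : IsExtraspecialQuotient p z) : Nat.card E = 2 * Nat.card W := by
  have h1 := p.ker.card_mul_index
  have h2 : (p.ker : Set E) = {1, z} := by
    ext e
    exact h.map_eq_one e
  have h3 : Nat.card p.ker = 2 := by
    change Nat.card (p.ker : Set E) = 2
    rw [h2, Nat.card_coe_set_eq, Set.ncard_pair h.ne_one.symm]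
  rw [Subgroup.index_ker, MonoidHom.range_eq_top.2 h.surjective, Subgroup.card_top, h3] at h1
  exact h1.symm

theorem range_action (h : IsExtraspecialQuotient p z) {q : QuadraticForm (ZMod 2) W}
    (hq : ∀ e, q (p e).toAdd = nontrivialIndicator (e ^ 2))
    {ρ : MulAut E →* (W ≃ₗ[ZMod 2] W)} (hρ : ∀ α e, ρ α (p e).toAdd = (p (α e)).toAdd) :
    ρ.range = isometryGroup q := by
  refine le_antisymm ?_ fun g hg => ?_
  · rintro _ ⟨α, rfl⟩ w
    obtain ⟨e, rfl⟩ := h.exists_toAdd_eq w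
    rw [hρ, hq, hq, ← map_pow, nontrivialIndicator_map]
  · obtain ⟨α, hα⟩ := h.exists_lift g fun e f hef => by
      rw [← nontrivialIndicator_eq_iff, ← hq, ← hq, hef]
      exact (hg _).symm
    refine ⟨α, ?_⟩
    ext w
    obtain ⟨e, rfl⟩ := h.exists_toAdd_eq w
    rw [hρ, hα]

/-- The automorphisms acting trivially on W are the inner ones, and Inn(E) ≅ E/Z(E) = W.
Equivariance is the identity that conjugating an inner automorphism by α gives the inner
automorphism of the image under α. -/
theorem exists_ker_mulEquiv (h : IsExtraspecialQuotient p z) [Finite W] {A : Type*} [Group A]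
    (Ψ : A ≃* MulAut E) {ρ : A →* (W ≃ₗ[ZMod 2] W)}
    (hρ : ∀ α e, ρ α (p e).toAdd = (p (Ψ α e)).toAdd) :
    ∃ ι : Multiplicative W ≃* ρ.ker, ∀ (α : A) (w : W),
      (ι (Multiplicative.ofAdd (ρ α w)) : A) = α * (ι (Multiplicative.ofAdd w) : A) * α⁻¹ := by
  have hker : ∀ α, α ∈ ρ.ker ↔ ∀ e, p (Ψ α e) = p e := by
    intro α
    rw [MonoidHom.mem_ker, LinearEquiv.ext_iff]
    constructor
    · intro hα e
      have := hα (p e).toAdd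
      rw [hρ] at this
      exact Multiplicative.toAdd.injective this
    · intro hα w
      obtain ⟨e, rfl⟩ := h.exists_toAdd_eq w
      rw [hρ, hα]
      rfl
  let κ : E →* ρ.ker := (Ψ.symm.toMonoidHom.comp MulAut.conj).codRestrict ρ.ker fun e => by
    rw [hker]
    intro f
    change p (Ψ (Ψ.symm (MulAut.conj e)) f) = p f
    rw [MulEquiv.apply_symm_apply, map_conj]
  have hκ : ∀ e, (κ e : A) = Ψ.symm (MulAut.conj e) := fun e => rfl
  have hκs : Function.Surjective κ := by
    rintro ⟨α, hα⟩
    obtain ⟨u, hu⟩ := h.exists_conj_of_map_eq (Ψ α) ((hker α).1 hα)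
    refine ⟨u, Subtype.ext ?_⟩
    rw [hκ, ← hu, MulEquiv.symm_apply_apply]
  obtain ⟨ι, hι⟩ := exists_mulEquiv_of_ker_iff p κ h.surjective hκs fun e => by
    rw [← h.conj_eq_one, Subtype.ext_iff, hκ, OneMemClass.coe_one]
    exact (map_eq_one_iff Ψ.symm Ψ.symm.injective).symm
  refine ⟨ι, fun α w => ?_⟩
  obtain ⟨e, rfl⟩ := h.exists_toAdd_eq w
  rw [hρ, ofAdd_toAdd, ofAdd_toAdd, hι, hι, hκ, hκ, MulEquiv.symm_apply_eq, map_mul, map_mul,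
    MulEquiv.apply_symm_apply, map_inv]
  ext f
  simp [MulAut.conj_apply]

end IsExtraspecialQuotient

/-! ### The action of C on the dent space -/

namespace IsFrame

variable {G : Type*} [Group G] {Q L : Subgroup G} [Q.Normal] {m : ℕ}
  {π : G →* GL (Fin 2) (ZMod 2)} {x t : G} (h : IsFrame Q L m π x t) [Finite Q]
include h

theorem map_mem_natSubgroup (α : autCentralizer L) {e a : Q}
    (ha : a ∈ h.isFixedPointFreeAction.natSubgroup e) :
    h.restrictQ α a ∈ h.isFixedPointFreeAction.natSubgroup (h.restrictQ α e) := by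
  have hc := h.isFixedPointFreeAction
  have h1 : hc.natSubgroup e ≤
      (hc.natSubgroup (h.restrictQ α e)).comap (h.restrictQ α).toMonoidHom := by
    refine hc.natSubgroup_le (fun c hcZ => ?_) (hc.self_mem_natSubgroup _) ?_
    · exact hc.center_le_natSubgroup _ (map_mem_center _ hcZ)
    · change h.restrictQ α (MulAut.conjNormal x e) ∈ hc.natSubgroup (h.restrictQ α e)
      rw [h.restrictQ_conjNormal α h.x_mem]
      exact hc.X_self_mem_natSubgroup _
  exact h1 ha

theorem natSubgroup_map (α : autCentralizer L) (e : Q) :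
    h.natSubgroup (h.restrictQ α e) = (h.natSubgroup e).map (α : MulAut G).toMonoidHom := by
  refine le_antisymm ?_ ?_
  · rintro _ ⟨a, ha, rfl⟩
    have h1 := h.map_mem_natSubgroup α⁻¹ ha
    rw [← MulAut.mul_apply, ← map_mul, inv_mul_cancel, map_one, MulAut.one_apply] at h1
    refine ⟨_, ⟨_, h1, rfl⟩, ?_⟩
    change ((h.restrictQ α (h.restrictQ α⁻¹ a) : Q) : G) = a
    rw [← MulAut.mul_apply, ← map_mul, mul_inv_cancel, map_one, MulAut.one_apply]
  · rintro _ ⟨_, ⟨a, ha, rfl⟩, rfl⟩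
    exact ⟨_, h.map_mem_natSubgroup α ha, rfl⟩

theorem exists_dent_map (α : autCentralizer L) (D : Dent Q) :
    ∃ (D' : Dent Q) (e : fixedSubgroup (MulAut.conjNormal t : MulAut Q)),
      D'.carrier = D.carrier.map (α : MulAut G).toMonoidHom ∧
      h.toDentSpace e = .ofDent D ∧ h.toDentSpace (h.restrictFixed α e) = .ofDent D' := by
  obtain ⟨e, he, heZ, rfl⟩ := h.exists_eq_dentOf D
  have hαZ : (h.restrictFixed α ⟨e, he⟩ : Q) ∉ Subgroup.center Q := by
    intro hZ
    have h1 := map_mem_center (h.restrictQ α⁻¹) hZ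
    rw [restrictFixed_apply, ← MulAut.mul_apply, ← map_mul, inv_mul_cancel, map_one,
      MulAut.one_apply] at h1
    exact heZ h1
  exact ⟨_, ⟨e, he⟩, h.natSubgroup_map α e, h.toDentSpace_of_notMem (e := ⟨e, he⟩) heZ,
    h.toDentSpace_of_notMem hαZ⟩

/-- An element of C_Q(t) central there is central in Q, and `t` fixes a single involution of Z. So
the fibre of `toDentSpace` over zero is the centre of C_Q(t), of order two. -/
theorem exists_isExtraspecialQuotient :
    ∃ (_ : AddCommGroup (DentSpace Q)) (_ : Module (ZMod 2) (DentSpace Q))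
      (p : fixedSubgroup (MulAut.conjNormal t : MulAut Q) →* Multiplicative (DentSpace Q))
      (z : fixedSubgroup (MulAut.conjNormal t : MulAut Q)),
      IsExtraspecialQuotient p z ∧ ∀ e, (p e).toAdd = h.toDentSpace e := by
  have hc := h.isFixedPointFreeAction
  obtain ⟨i₁, i₂, p, hp⟩ := exists_module_of_surjective
    ((Subgroup.center Q).subgroupOf (fixedSubgroup (MulAut.conjNormal t : MulAut Q)))
    (fun a => hc.sq_mem a) h.toDentSpace h.toDentSpace_surjective
    (fun a b => h.toDentSpace_eq_iff a b)
  obtain ⟨z, hzZ, hz1, hTz, hz⟩ := hc.exists_fixed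
  have hp0 : (0 : DentSpace Q) = .zero := by
    rw [← h.toDentSpace_of_mem (e := 1) (Subgroup.one_mem _), ← hp, map_one]
    rfl
  have hp1 : ∀ e, p e = 1 ↔ (e : Q) ∈ Subgroup.center Q := by
    intro e
    rw [← toAdd_eq_zero, hp, hp0, h.toDentSpace_eq_zero]
  refine ⟨i₁, i₂, p, ⟨z, hTz⟩, ⟨?_, ?_, ?_, ?_⟩, hp⟩
  · intro w
    obtain ⟨e, he⟩ := h.toDentSpace_surjective w.toAdd
    exact ⟨e, Multiplicative.toAdd.injective ((hp e).trans he)⟩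
  · exact fun h1 => hz1 (congrArg Subtype.val h1)
  · intro e
    rw [hp1]
    constructor
    · intro heZ
      rcases hz e heZ e.2 with h1 | h1
      · exact Or.inl (Subtype.ext h1)
      · exact Or.inr (Subtype.ext h1)
    · rintro (rfl | rfl)
      · exact Subgroup.one_mem _
      · exact hzZ
  · intro e
    rw [hp1]
    constructor
    · exact fun heZ f => Subtype.ext (mem_center_comm heZ f)
    · exact fun hef => hc.mem_center_of_commute_fixed fun f hf =>
        congrArg Subtype.val (hef ⟨f, hf⟩)

end IsFrame

end Biextraspecial

/-! ### C as an extension of the dent space by its orthogonal group -/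

theorem mainTheorem4 {G : Type*} [Group G] (Q L : Subgroup G) [Q.Normal] (m : ℕ)
    (hG : IsBiextraspecial Q m) (hL : Q.IsComplement' L) :
    -- the natural map from `C` to `Out(G)` is an isomorphism
    (∃ e : autCentralizer L ≃* Out G, ∀ α, e α = QuotientGroup.mk (α : MulAut G)) ∧
    -- the dent space is an `m`-dimensional vector space over the field with two elements
    ∃ (_ : AddCommGroup (DentSpace Q)) (_ : Module (ZMod 2) (DentSpace Q)),
      (0 : DentSpace Q) = .zero ∧
      (∀ x y z : DentSpace Q, x + y = z ↔ IsDentSum x y z) ∧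
      Module.finrank (ZMod 2) (DentSpace Q) = m ∧
      -- `q` is a quadratic form with associated nondegenerate bilinear form `β`
      ∃ q : QuadraticForm (ZMod 2) (DentSpace Q),
        (∀ x, q x = dentQ x) ∧
        (∀ x y, QuadraticMap.polar q x y = dentBeta x y) ∧
        (∀ x : DentSpace Q, (∀ y, dentBeta x y = 0) → x = 0) ∧
        -- the linear action of `C` on the dent space
        ∃ ρ : autCentralizer L →* (DentSpace Q ≃ₗ[ZMod 2] DentSpace Q),
          (∀ (α : autCentralizer L) (D : Dent Q), ∃ E : Dent Q,
            E.carrier = D.carrier.map (α : MulAut G).toMonoidHom ∧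
            ρ α (.ofDent D) = .ofDent E) ∧
          -- its image is the whole orthogonal group of `q`
          ρ.range = isometryGroup q ∧
          -- its kernel is elementary abelian of rank `m`, and isomorphic to the dent space
          -- as a module for `C`
          Nonempty (ρ.ker ≃* Multiplicative (Fin m → ZMod 2)) ∧
          (∃ ι : Multiplicative (DentSpace Q) ≃* ρ.ker,
            ∀ (α : autCentralizer L) (x : DentSpace Q),
              (ι (Multiplicative.ofAdd (ρ α x)) : autCentralizer L) =
                α * (ι (Multiplicative.ofAdd x) : autCentralizer L) * α⁻¹) ∧
          -- `q` has a type `ε`, and the quotient by the kernel is `GO^ε_m(2)`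
          ∃ (ε : FormType) (n : ℕ), m = 2 * n ∧
            QuadraticMap.Equivalent q (stdForm ε n) ∧
            Nonempty ((autCentralizer L ⧸ ρ.ker) ≃* GO ε n) := by
  obtain ⟨π, x, t, h⟩ := exists_isFrame hG hL
  have hfinQ := h.finite_Q
  refine ⟨exists_autCentralizer_mulEquiv_out h, ?_⟩
  obtain ⟨i₁, i₂, p, z, hE, hp⟩ := h.exists_isExtraspecialQuotient
  have hadd : ∀ e f, h.toDentSpace e + h.toDentSpace f = h.toDentSpace (e * f) := fun e f => by
    rw [← hp, ← hp, ← hp, map_mul, toAdd_mul]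
  have hcard : Nat.card (DentSpace Q) = 2 ^ m := by
    have h1 := h.isFixedPointFreeAction.card_eq_sq
    rw [hG.card_eq, hE.card_eq] at h1
    -- The order 2^(2+2m) of Q is the square of that of C_Q(t), which in turn is twice the number of
    -- elements of the dent space.
    have h2 : (2 ^ (1 + m)) ^ 2 = (2 * Nat.card (DentSpace Q)) ^ 2 := by
      rw [← h1]
      ring
    have h3 := Nat.pow_left_injective (n := 2) (by decide) h2
    rw [pow_add, pow_one] at h3
    exact (Nat.eq_of_mul_eq_mul_left (by decide) h3).symm
  have hfinW : Finite (DentSpace Q) := Nat.finite_of_card_ne_zero (by rw [hcard]; positivity)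
  have hmodW : Module.Finite (ZMod 2) (DentSpace Q) := Module.Finite.of_finite
  have hrank : Module.finrank (ZMod 2) (DentSpace Q) = m := by
    have h1 := Module.natCard_eq_pow_finrank (K := ZMod 2) (V := DentSpace Q)
    rw [Nat.card_zmod, hcard] at h1
    exact (Nat.pow_right_injective le_rfl h1).symm
  obtain ⟨q, hq, hpol⟩ := hE.exists_quadraticForm
  obtain ⟨ρE, hρE⟩ := hE.exists_action
  -- The action of C is that of Aut(C_Q(t)), carried over by restriction.
  let Ψ := MulEquiv.ofBijective h.restrictFixed h.restrictFixed_bijective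
  let ρ : autCentralizer L →* (DentSpace Q ≃ₗ[ZMod 2] DentSpace Q) := ρE.comp Ψ.toMonoidHom
  have hρ : ∀ α e, ρ α (p e).toAdd = (p (Ψ α e)).toAdd := fun α e => hρE _ e
  have hpoldent : ∀ x y, QuadraticMap.polar q x y = dentBeta x y := by
    intro x y
    obtain ⟨e, rfl⟩ := hE.exists_toAdd_eq x
    obtain ⟨f, rfl⟩ := hE.exists_toAdd_eq y
    rw [hpol, hp, hp, h.dentBeta_toDentSpace]
  have hrange : ρ.range = isometryGroup q := by
    rw [← hE.range_action hq hρE]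
    ext g
    constructor
    · rintro ⟨α, rfl⟩
      exact ⟨Ψ α, rfl⟩
    · rintro ⟨β, rfl⟩
      exact ⟨Ψ.symm β, congrArg ρE (Ψ.apply_symm_apply β)⟩
  obtain ⟨ι, hι⟩ := hE.exists_ker_mulEquiv Ψ hρ
  obtain ⟨ε, n, hmn, hstd⟩ := exists_equivalent_stdForm m (DentSpace Q) q hrank
    (fun x hx => hE.nondegenerate hpol x hx)
  refine ⟨i₁, i₂, ?_, ?_, hrank, q, ?_, hpoldent, ?_, ρ, ?_, hrange, ?_, ⟨ι, hι⟩, ε, n, hmn,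
    hstd, ?_⟩
  · rw [← h.toDentSpace_of_mem (e := 1) (Subgroup.one_mem _), ← hp, map_one]
    rfl
  · intro a b c
    obtain ⟨e, rfl⟩ := h.toDentSpace_surjective a
    obtain ⟨f, rfl⟩ := h.toDentSpace_surjective b
    obtain ⟨g, rfl⟩ := h.toDentSpace_surjective c
    rw [hadd]
    constructor
    · intro h1
      rw [← h1]
      exact h.isDentSum_toDentSpace e f
    · exact h.toDentSpace_mul_of_isDentSum
  · intro w
    obtain ⟨e, rfl⟩ := hE.exists_toAdd_eq w
    rw [hq, hp, h.dentQ_toDentSpace]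
  · intro w hw
    exact hE.nondegenerate hpol w fun v => by rw [hpoldent, hw]
  · intro α D
    obtain ⟨D', e, hD', he, hαe⟩ := h.exists_dent_map α D
    exact ⟨D', hD', by rw [← he, ← hp, hρ, hp, ← hαe]; rfl⟩
  · have e : DentSpace Q ≃ₗ[ZMod 2] (Fin m → ZMod 2) :=
      LinearEquiv.ofFinrankEq _ _ (by rw [hrank, Module.finrank_fin_fun])
    exact ⟨ι.symm.trans (AddEquiv.toMultiplicative e.toAddEquiv)⟩
  · obtain ⟨ψ⟩ := nonempty_isometryGroup_mulEquiv hstd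
    exact ⟨(QuotientGroup.quotientKerEquivRange ρ).trans
      ((MulEquiv.subgroupCongr hrange).trans ψ)⟩
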